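/- **Setting.** A language $L$ consists of relation symbols $R$ with arities $a(R)$ and function symbols $F$ with domain arity $d(F)$ and range arity $r(F)$. An $L$-structure $\mathbf A$ has a vertex set $A$, relations $R_{\mathbf A}\subseteq A^{a(R)}$, and partial functions $F_{\mathbf A}\colon \mathrm{Dom}(F_{\mathbf A})\to\binom{A}{r(F)}$ with $\mathrm{Dom}(F_{\mathbf A})\subseteq A^{d(F)}$, where $\binom{A}{r}$ is the set of $r$-element subsets of $A$. An embedding $f\colon\mathbf A\to\mathbf B$ is an injective map with $x\in R_{\mathbf A}\iff f(x)\in R_{\mathbf B}$, $x\in \mathrm{Dom}(F_{\mathbf A})\iff f(x)\in \mathrm{Dom}(F_{\mathbf B})$, and $f(F_{\mathbf A}(x))=F_{\mathbf B}(f(x))$ for $x\in\mathrm{Dom}(F_{\mathbf A})$. Isomorphisms are bijective embeddings, and $\mathbf A$ is a substructure of $\mathbf B$ if $A\subseteq B$ and the inclusion is an embedding (so vertex sets of substructures are closed under the functions). The empty structure is allowed. Let $\alpha_i\colon\mathbf A\to\mathbf B_i$ ($i=1,2$) be embeddings. A free amalgamation of $\mathbf B_1,\mathbf B_2$ over $\mathbf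 A$ is a structure $\mathbf C$ with embeddings $\beta_i\colon\mathbf B_i\to\mathbf C$ such that $\beta_1\alpha_1=\beta_2\alpha_2$, $C=\beta_1(B_1)\cup\beta_2(B_2)$, $\beta_1(x_1)=\beta_2(x_2)$ only if $x_1=\alpha_1(a)$ and $x_2=\alpha_2(a)$ for some $a\in A$, and no tuple in a relation of $\mathbf C$ or in the domain of a function of $\mathbf C$ contains vertices of both $\beta_1(B_1\setminus\alpha_1(A))$ and $\beta_2(B_2\setminus\alpha_2(A))$. A structure is irreducible if it is not the free amalgamation of two of its proper substructures over their intersection. A free amalgamation class is an isomorphism-closed class $\mathcal K$ of finite $L$-structures that is closed under substructures, in which any two members embed into a common member, and such that for all $\mathbf A,\mathbf B_1,\mathbf B_2\in\mathcal K$ and embeddings $\alpha_i\colon\mathbf A\to\mathbf B_i$ the free amalgamation of $\mathbf B_1,\mathbf B_2$ over $\mathbf A$ belongs to $\mathcal K$. A partial automorphism of $\mathbf A$ is an isomorphism $f\colon\mathbf D\to\mathbf E$ between substructures of $\mathbf A$. A triple $(f,g,h)$ of partial automorphisms is coherent if $\mathrm{Dom}(f)=\mathrm{Dom}(h)$, $\mathrm{Range}(f)=\mathrm{Dom}(g)$,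 $\mathrm{Range}(g)=\mathrm{Range}(h)$ and $h=g\circ f$. An EPPA-extension of $\mathbf A$ is a structure $\mathbf B$ containing $\mathbf A$ (up to isomorphism) as a substructure such that every partial automorphism of $\mathbf A$ extends to an automorphism of $\mathbf B$. It is coherent if there is a choice of extensions $f\mapsto\hat f\in\mathrm{Aut}(\mathbf B)$ with $\hat h=\hat g\circ\hat f$ for every coherent triple $(f,g,h)$ of partial automorphisms of $\mathbf A$. It is irreducible substructure faithful if for every irreducible substructure $\mathbf C$ of $\mathbf B$ there is $g\in\mathrm{Aut}(\mathbf B)$ with $g(C)\subseteq A$. **Theorem 1.7 (EPPA).** Let $L$ be a language such that every function symbol of $L$ is unary, i.e. $d(F)=1$. Then every finite $L$-structure $\mathbf A$ has a finite EPPA-extension $\mathbf B$ that is both coherent and irreducible substructure faithful. Consequently every free amalgamation class $\mathcal K$ of finite $L$-structures has the coherent extension property for partial automorphisms: every $\mathbf A\in\mathcal K$ has a coherent EPPA-extension $\mathbf B\in\mathcal K$. -/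

import Mathlib

universe u v w

/-- A language with relation symbols (each with an arity) and function symbols (each with a
domain arity `d(F)` and a range arity `r(F)`). No finiteness or countability is assumed. -/
structure PLanguage where
  Rel : Type u
  arity : Rel → ℕ
  Func : Type v
  domArity : Func → ℕ
  ranArity : Func → ℕ

namespace PLanguage

/-- An `L`-structure with vertex set `V`: every relation symbol is interpreted by a set of tuples,
and every function symbol `F` by a *partial* function from `d(F)`-tuples of vertices to
`r(F)`-element *sets* of vertices. The partial function is given by its graph:
`A.fn F x s` says that `x` is in the domain of `F` and that its value is `s`. -/
structure Str (L : PLanguage.{u, v}) (V : Type w) where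
  rel : (R : L.Rel) → Set (Fin (L.arity R) → V)
  fn : (F : L.Func) → (Fin (L.domArity F) → V) → Finset V → Prop
  fn_unique : ∀ F x s t, fn F x s → fn F x t → s = t
  fn_card : ∀ F x s, fn F x s → s.card = L.ranArity F

namespace Str

variable {L : PLanguage.{u, v}} {V W : Type w}

/-- The domain of the partial function `F` in `A`. -/
def funDom (A : Str L V) (F : L.Func) : Set (Fin (L.domArity F) → V) :=
  {x | ∃ s, A.fn F x s}

/-- Homomorphisms; the value sets are mapped onto the value sets. -/
structure IsHom (A : Str L V) (B : Str L W) (f : V → W) : Prop where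
  map_rel : ∀ R x, x ∈ A.rel R → f ∘ x ∈ B.rel R
  map_fn : ∀ F x s, A.fn F x s → ∃ t, B.fn F (f ∘ x) t ∧ (t : Set W) = f '' (s : Set V)

/-- Embeddings: injective homomorphisms that reflect relations and domains of functions. -/
structure IsEmbedding (A : Str L V) (B : Str L W) (f : V → W) : Prop extends IsHom A B f where
  injective : Function.Injective f
  rel_iff : ∀ R x, x ∈ A.rel R ↔ f ∘ x ∈ B.rel R
  dom_iff : ∀ F x, x ∈ A.funDom F ↔ f ∘ x ∈ B.funDom F

/-- Isomorphisms: bijective embeddings. -/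
def IsIso (A : Str L V) (B : Str L W) (f : V ≃ W) : Prop := IsEmbedding A B f

/-- Automorphisms of `A`. -/
def IsAut (A : Str L V) (g : Equiv.Perm V) : Prop := IsIso A A g

/-- A set of vertices is closed if it contains the values of all functions at all tuples of its
elements. The closed sets are exactly the vertex sets of substructures. -/
def IsClosed (A : Str L V) (S : Set V) : Prop :=
  ∀ F x s, (∀ i, x i ∈ S) → A.fn F x s → (s : Set V) ⊆ S

/-- The restriction of all relations and functions of `A` to `S`. When `S` is closed, this is
the substructure of `A` with vertex set `S`. -/
def induce (A : Str L V) (S : Set V) : Str L S where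
  rel R := {x | (fun i => (x i : V)) ∈ A.rel R}
  fn F x s := A.fn F (fun i => (x i : V)) (s.map (Function.Embedding.subtype (· ∈ S)))
  fn_unique F x s t hs ht := Finset.map_injective _ (A.fn_unique F _ _ _ hs ht)
  fn_card F x s hs := by simpa using A.fn_card F _ _ hs

/-- For closed `S`, the inclusion of the induced structure is an embedding. -/
theorem isEmbedding_induce (A : Str L V) {S : Set V} (hS : A.IsClosed S) :
    IsEmbedding (A.induce S) A (Subtype.val : S → V) where
  map_rel R x hx := hx
  map_fn F x s hs := ⟨_, hs, by simp⟩
  injective := Subtype.val_injective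
  rel_iff R x := Iff.rfl
  dom_iff F x := by
    constructor
    · rintro ⟨s, hs⟩
      exact ⟨_, hs⟩
    · rintro ⟨t, ht⟩
      have hsub : (t : Set V) ⊆ S := hS F _ t (fun i => (x i).2) ht
      classical
      refine ⟨t.subtype (· ∈ S), ?_⟩
      have : (t.subtype (· ∈ S)).map (Function.Embedding.subtype (· ∈ S)) = t :=
        Finset.subtype_map_of_mem fun a ha => hsub (by simpa using ha)
      change A.fn F _ (Finset.map _ _)
      rw [this]
      exact ht

/-- `C` (with `β₁`, `β₂`) is an amalgamation of `B₁` and `B₂` over `A` with respect to the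
embeddings `α₁`, `α₂`. -/
structure IsAmalgamation {U V₁ V₂ W : Type w} (A : Str L U) (B₁ : Str L V₁) (B₂ : Str L V₂)
    (C : Str L W) (α₁ : U → V₁) (α₂ : U → V₂) (β₁ : V₁ → W) (β₂ : V₂ → W) : Prop where
  emb_left : IsEmbedding B₁ C β₁
  emb_right : IsEmbedding B₂ C β₂
  comm : β₁ ∘ α₁ = β₂ ∘ α₂

/-- `C` (with `β₁`, `β₂`) is the free amalgamation of `B₁` and `B₂` over `A`: its vertices are
those of the two copies, two vertices are identified only if they come from the same vertex of
`A`, and no tuple in a relation or in the domain of a function meets both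
`β₁(B₁ \ α₁(A))` and `β₂(B₂ \ α₂(A))`. -/
structure IsFreeAmalgamation {U V₁ V₂ W : Type w} (A : Str L U) (B₁ : Str L V₁) (B₂ : Str L V₂)
    (C : Str L W) (α₁ : U → V₁) (α₂ : U → V₂) (β₁ : V₁ → W) (β₂ : V₂ → W) : Prop
    extends IsAmalgamation A B₁ B₂ C α₁ α₂ β₁ β₂ where
  union : Set.range β₁ ∪ Set.range β₂ = Set.univ
  inter : ∀ x₁ x₂, β₁ x₁ = β₂ x₂ ↔ ∃ a, α₁ a = x₁ ∧ α₂ a = x₂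
  rel_free : ∀ R, ∀ x ∈ C.rel R,
    ¬ ((∃ i, x i ∈ β₁ '' (Set.range α₁)ᶜ) ∧ (∃ j, x j ∈ β₂ '' (Set.range α₂)ᶜ))
  dom_free : ∀ F, ∀ x ∈ C.funDom F,
    ¬ ((∃ i, x i ∈ β₁ '' (Set.range α₁)ᶜ) ∧ (∃ j, x j ∈ β₂ '' (Set.range α₂)ᶜ))

/-- `A` is irreducible if it is not the free amalgamation of two of its proper substructures
(over their intersection, with respect to the inclusions). -/
def Irreducible (A : Str L V) : Prop :=
  ¬ ∃ S T : Set V, A.IsClosed S ∧ A.IsClosed T ∧ S ≠ Set.univ ∧ T ≠ Set.univ ∧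
    IsFreeAmalgamation (A.induce (S ∩ T)) (A.induce S) (A.induce T) A
      (Set.inclusion Set.inter_subset_left) (Set.inclusion Set.inter_subset_right)
      Subtype.val Subtype.val

/-- A partial automorphism of `A`: an isomorphism between two substructures of `A`. -/
structure PartialAut (A : Str L V) where
  dom : Set V
  ran : Set V
  dom_closed : A.IsClosed dom
  ran_closed : A.IsClosed ran
  map : dom ≃ ran
  isIso : IsIso (A.induce dom) (A.induce ran) map

/-- `(f, g, h)` is a coherent triple: `Dom f = Dom h`, `Range f = Dom g`, `Range g = Range h` and
`h = g ∘ f`. -/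
def PartialAut.CoherentTriple {A : Str L V} (f g h : A.PartialAut) : Prop :=
  f.dom = h.dom ∧ f.ran = g.dom ∧ g.ran = h.ran ∧
    ∀ (x : f.dom) (y : g.dom) (z : h.dom), (z : V) = x → (y : V) = f.map x →
      (h.map z : V) = g.map y

/-- The permutation `g` extends the partial automorphism `p`, where the vertices of `A` are
regarded as vertices of an extension through `φ`. -/
def PartialAut.ExtendsTo {A : Str L V} (p : A.PartialAut) (φ : V → W) (g : Equiv.Perm W) : Prop :=
  ∀ x : p.dom, g (φ x) = φ (p.map x)

/-- `B`, with `A` regarded as a substructure through `φ`, is an EPPA-extension of `A`. -/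
def IsEPPAExtension (A : Str L V) (B : Str L W) (φ : V → W) : Prop :=
  IsEmbedding A B φ ∧ ∀ p : A.PartialAut, ∃ g : Equiv.Perm W, B.IsAut g ∧ p.ExtendsTo φ g

/-- `B` is a coherent EPPA-extension of `A`: automorphisms extending the partial automorphisms
can be chosen so that coherent triples go to coherent triples. Automorphisms have full domain
and range, so a triple of them is coherent as soon as the third is the composition. -/
def IsCoherentEPPAExtension (A : Str L V) (B : Str L W) (φ : V → W) : Prop :=
  IsEPPAExtension A B φ ∧ ∃ ext : A.PartialAut → Equiv.Perm W,
    (∀ p, B.IsAut (ext p) ∧ p.ExtendsTo φ (ext p)) ∧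
    ∀ f g h : A.PartialAut, PartialAut.CoherentTriple f g h → ⇑(ext h) = ⇑(ext g) ∘ ⇑(ext f)

/-- Every irreducible substructure of `B` is mapped into the copy of `A` by some automorphism
of `B`. -/
def IsIrreducibleFaithful (B : Str L W) (φ : V → W) : Prop :=
  ∀ S : Set W, B.IsClosed S → (B.induce S).Irreducible →
    ∃ g : Equiv.Perm W, B.IsAut g ∧ g '' S ⊆ Set.range φ

end Str

/-- A free amalgamation class: an isomorphism-closed class of finite `L`-structures with the
hereditary property, the joint embedding property, and the amalgamation property in the strong
form that the amalgamation can always be chosen to be the free one. -/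
structure IsFreeAmalgamationClass {L : PLanguage.{u, v}}
    (K : ∀ V : Type w, Str L V → Prop) : Prop where
  finite : ∀ (V : Type w) (A : Str L V), K V A → Finite V
  iso : ∀ (V W : Type w) (A : Str L V) (B : Str L W) (e : V ≃ W),
    Str.IsIso A B e → K V A → K W B
  hereditary : ∀ (V : Type w) (A : Str L V), K V A →
    ∀ S : Set V, A.IsClosed S → K S (A.induce S)
  joint_embedding : ∀ (V₁ V₂ : Type w) (A : Str L V₁) (B : Str L V₂), K V₁ A → K V₂ B →
    ∃ (W : Type w) (C : Str L W) (f : V₁ → W) (g : V₂ → W),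
      K W C ∧ Str.IsEmbedding A C f ∧ Str.IsEmbedding B C g
  free_amalgamation : ∀ (U V₁ V₂ : Type w) (A : Str L U) (B₁ : Str L V₁) (B₂ : Str L V₂)
    (α₁ : U → V₁) (α₂ : U → V₂), K U A → K V₁ B₁ → K V₂ B₂ →
    Str.IsEmbedding A B₁ α₁ → Str.IsEmbedding A B₂ α₂ →
    ∃ (W : Type w) (C : Str L W) (β₁ : V₁ → W) (β₂ : V₂ → W),
      K W C ∧ Str.IsFreeAmalgamation A B₁ B₂ C α₁ α₂ β₁ β₂

/-- The coherent extension property for partial automorphisms of a class of structures. -/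
def HasCoherentEPPA {L : PLanguage.{u, v}} (K : ∀ V : Type w, Str L V → Prop) : Prop :=
  ∀ (V : Type w) (A : Str L V), K V A →
    ∃ (W : Type w) (B : Str L W) (φ : V → W), K W B ∧ Str.IsCoherentEPPAExtension A B φ

end PLanguage

/-!
The coherent EPPA-extension of a finite structure `A` with unary functions is obtained by three
constructions, each of which turns partial automorphisms into permutations of a larger finite set.
Coherence has one source: a partial injection of a finite linear order extends to a unique
permutation that is increasing outside of the domain (`exists_perm_strictMonoOn`,
`perm_eq_of_strictMonoOn`), so composing extensions gives the extension of the composition.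

*Relations* (`exists_relational_extension`). The vertices of `A` are paired with valuations in
`ℤ/2`, one for each kind of tuple, and a tuple is related or not according to the parity of the sum
of its valuations; `A` is embedded with zero valuations. Extending a partial automorphism to all
vertices of `A` may destroy relations only on tuples that leave its domain, and there the valuation
of one free vertex can be changed to repair the parity.

*Functions* (`exists_isCoherentEPPAExtension`). A vertex is replaced by a pair consisting of the
vertex and of the functions on its closure, where closures of vertices of `A` are moved by all
relation-preserving permutations. Since functions are unary, the closure determines their values,
and an automorphism acts on closures in the obvious way.

*Faithfulness* (`IsCoherentEPPAExtension.exists_faithful`). Given an extension `B`, call a family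
of vertices bad if no automorphism moves it into `A`. Vertices of `B` are paired with valuations
that injectively assign values to the indices of bad families whose vertices lie in their closure,
with one value fewer than there are indices, and related tuples must carry compatible valuations.
In an irreducible structure any two vertices lie in the closure of one vertex or of one related
tuple (`Irreducible.exists_reach`), so an irreducible substructure is pairwise compatible, and by
the pigeonhole principle it cannot project onto a bad family. It therefore moves into `A`.

For a free amalgamation class, a faithful extension of a member is built from its irreducible
substructures, which are copies of substructures of `A`, by free amalgamations, and these are
unique up to isomorphism (`IsFreeAmalgamation.exists_isIso`).
-/

namespace PLanguage

namespace Str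

variable {L : PLanguage.{u, v}} {U V W : Type w}

/-! ### Embeddings, isomorphisms and automorphisms -/

theorem IsEmbedding.fn_map {A : Str L V} {B : Str L W} {f : V → W} (h : IsEmbedding A B f)
    {F : L.Func} {x : Fin (L.domArity F) → V} {s : Finset V} (hs : A.fn F x s) :
    B.fn F (f ∘ x) (s.map ⟨f, h.injective⟩) := by
  obtain ⟨t, ht, hts⟩ := h.map_fn F x s hs
  have : s.map ⟨f, h.injective⟩ = t := by
    apply Finset.coe_injective
    simp [hts]
  rwa [this]

theorem IsEmbedding.fn_iff {A : Str L V} {B : Str L W} {f : V → W} (h : IsEmbedding A B f)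
    {F : L.Func} {x : Fin (L.domArity F) → V} {s : Finset V} :
    A.fn F x s ↔ B.fn F (f ∘ x) (s.map ⟨f, h.injective⟩) := by
  refine ⟨h.fn_map, fun hs => ?_⟩
  obtain ⟨t, ht⟩ := (h.dom_iff F x).2 ⟨_, hs⟩
  have := B.fn_unique _ _ _ _ hs (h.fn_map ht)
  rwa [Finset.map_injective _ this]

theorem isEmbedding_of_fn_map {A : Str L V} {B : Str L W} {f : V → W}
    (inj : Function.Injective f) (rel : ∀ R x, x ∈ A.rel R ↔ f ∘ x ∈ B.rel R)
    (fn : ∀ F x s, A.fn F x s → B.fn F (f ∘ x) (s.map ⟨f, inj⟩))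
    (dom : ∀ F x t, B.fn F (f ∘ x) t → ∃ s, A.fn F x s) : IsEmbedding A B f where
  map_rel R x hx := (rel R x).1 hx
  map_fn F x s hs := ⟨_, fn F x s hs, by simp⟩
  injective := inj
  rel_iff := rel
  dom_iff F x := ⟨fun ⟨s, hs⟩ => ⟨_, fn F x s hs⟩, fun ⟨t, ht⟩ => dom F x t ht⟩

theorem IsEmbedding.comp {A : Str L U} {B : Str L V} {C : Str L W} {g : V → W} {f : U → V}
    (hg : IsEmbedding B C g) (hf : IsEmbedding A B f) : IsEmbedding A C (g ∘ f) := by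
  refine isEmbedding_of_fn_map (hg.injective.comp hf.injective)
    (fun R x => (hf.rel_iff R x).trans (hg.rel_iff R _)) (fun F x s hs => ?_) fun F x t ht => ?_
  · have := hg.fn_map (hf.fn_map hs)
    rwa [Finset.map_map] at this
  · exact (hf.dom_iff F x).2 ((hg.dom_iff F _).2 ⟨t, ht⟩)

theorem IsIso.symm {A : Str L V} {B : Str L W} {e : V ≃ W} (h : IsIso A B e) :
    IsIso B A e.symm := by
  have hx : ∀ {n : ℕ} (x : Fin n → W), e ∘ (e.symm ∘ x) = x := fun x => by ext; simp
  refine isEmbedding_of_fn_map e.symm.injective (fun R x => ?_) (fun F x s hs => ?_)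
    fun F x t ht => ?_
  · rw [IsEmbedding.rel_iff h, hx]
  · rw [IsEmbedding.fn_iff h, hx]
    convert hs
    ext; simp
  · have := IsEmbedding.fn_map h ht
    rw [hx] at this
    exact ⟨_, this⟩

/-- A bijection that is a homomorphism in both directions is an isomorphism. -/
theorem isIso_of_isHom {A : Str L V} {B : Str L W} (e : V ≃ W) (h : IsHom A B e)
    (h' : IsHom B A e.symm) : IsIso A B e where
  toIsHom := h
  injective := e.injective
  rel_iff R x := ⟨h.map_rel R x, fun hx => by
    simpa [Function.comp_def] using h'.map_rel R _ hx⟩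
  dom_iff F x := by
    constructor
    · rintro ⟨s, hs⟩
      obtain ⟨t, ht, -⟩ := h.map_fn F x s hs
      exact ⟨t, ht⟩
    · rintro ⟨s, hs⟩
      obtain ⟨t, ht, -⟩ := h'.map_fn F _ s hs
      exact ⟨t, by simpa [Function.comp_def] using ht⟩

theorem isAut_one (A : Str L V) : A.IsAut 1 :=
  isIso_of_isHom 1 ⟨fun _ _ hx => hx, fun _ _ s hs => ⟨s, hs, (Set.image_id _).symm⟩⟩
    ⟨fun _ _ hx => hx, fun _ _ s hs => ⟨s, hs, (Set.image_id _).symm⟩⟩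

theorem IsAut.mul {A : Str L V} {g h : Equiv.Perm V} (hg : A.IsAut g) (hh : A.IsAut h) :
    A.IsAut (g * h) :=
  IsEmbedding.comp (g := g) (f := h) hg hh

theorem IsAut.inv {A : Str L V} {g : Equiv.Perm V} (hg : A.IsAut g) : A.IsAut g⁻¹ :=
  IsIso.symm hg

theorem IsEmbedding.isClosed_image {A : Str L V} {B : Str L W} {f : V → W}
    (h : IsEmbedding A B f) {S : Set V} (hS : A.IsClosed S) : B.IsClosed (f '' S) := by
  intro F x s hx hs
  choose y hyS hy using hx
  obtain rfl : f ∘ y = x := funext hy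
  obtain ⟨t, ht⟩ := (h.dom_iff F y).2 ⟨s, hs⟩
  rw [B.fn_unique _ _ _ _ hs (h.fn_map ht)]
  simpa using Set.image_mono (hS F y t hyS ht)

theorem IsEmbedding.isClosed_preimage {A : Str L V} {B : Str L W} {f : V → W}
    (h : IsEmbedding A B f) {S : Set W} (hS : B.IsClosed S) : A.IsClosed (f ⁻¹' S) := by
  intro F x s hx hs
  have := hS F _ _ hx (h.fn_map hs)
  simpa using this

theorem isClosed_univ (A : Str L V) : A.IsClosed Set.univ := fun _ _ _ _ _ => Set.subset_univ _

/-! ### Generated substructures in languages with unary functions -/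

/-- `A.Arrow x y` holds when `y` belongs to the value of some unary function at `x`. -/
def Arrow (A : Str L V) (x y : V) : Prop := ∃ F s, A.fn F (fun _ => x) s ∧ y ∈ s

/-- `A.Reach x y` holds when `y` lies in the substructure generated by `x`, provided that all
functions are unary. -/
def Reach (A : Str L V) : V → V → Prop := Relation.ReflTransGen A.Arrow

theorem exists_eq_const (hL : ∀ F : L.Func, L.domArity F = 1) {F : L.Func}
    (x : Fin (L.domArity F) → V) : ∃ a, x = fun _ => a := by
  have : Subsingleton (Fin (L.domArity F)) := by rw [hL]; infer_instance
  exact ⟨x ⟨0, by simp [hL]⟩, funext fun i => congrArg x (Subsingleton.elim _ _)⟩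

theorem const_injective (hL : ∀ F : L.Func, L.domArity F = 1) (F : L.Func) {a b : V}
    (h : (fun _ : Fin (L.domArity F) => a) = fun _ => b) : a = b :=
  congrFun h ⟨0, by simp [hL]⟩

theorem Reach.mem_of_isClosed {A : Str L V} {S : Set V} (hS : A.IsClosed S) {x y : V}
    (h : A.Reach x y) (hx : x ∈ S) : y ∈ S := by
  induction h with
  | refl => exact hx
  | tail _ h ih =>
    obtain ⟨F, s, hs, hy⟩ := h
    exact hS F _ s (fun _ => ih) hs hy

theorem isClosed_of_arrow (hL : ∀ F : L.Func, L.domArity F = 1) {A : Str L V} {S : Set V}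
    (h : ∀ x y, A.Arrow x y → x ∈ S → y ∈ S) : A.IsClosed S := by
  intro F x s hx hs y hy
  obtain ⟨a, rfl⟩ := exists_eq_const hL x
  exact h a y ⟨F, s, hs, hy⟩ (hx ⟨0, by simp [hL]⟩)

theorem IsEmbedding.reach {A : Str L V} {B : Str L W} {f : V → W} (h : IsEmbedding A B f)
    {x y : V} (hxy : A.Reach x y) : B.Reach (f x) (f y) := by
  refine Relation.ReflTransGen.lift f ?_ _ _ hxy
  rintro a b ⟨F, s, hs, hb⟩
  exact ⟨F, _, h.fn_map hs, by simpa using hb⟩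

theorem IsAut.reach_iff {A : Str L V} {g : Equiv.Perm V} (h : A.IsAut g) {x y : V} :
    A.Reach (g x) (g y) ↔ A.Reach x y :=
  ⟨fun hr => by simpa using IsEmbedding.reach h.inv hr, IsEmbedding.reach h⟩

/-- In an irreducible structure with unary functions, any two vertices lie in a substructure
generated by a single vertex or by a tuple of some relation. -/
theorem Irreducible.exists_reach (hL : ∀ F : L.Func, L.domArity F = 1) {A : Str L V}
    (hA : A.Irreducible) (x y : V) : (∃ z, A.Reach z x ∧ A.Reach z y) ∨
      ∃ R, ∃ t ∈ A.rel R, ∃ i j, A.Reach (t i) x ∧ A.Reach (t j) y := by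
  by_contra! hcon
  obtain ⟨h1, h2⟩ := hcon
  -- the largest substructures avoiding `y` and `x` respectively
  have hcl : ∀ y, A.IsClosed {z | ¬ A.Reach z y} := fun y =>
    isClosed_of_arrow hL fun a b hab ha hb => ha (Relation.ReflTransGen.head hab hb)
  refine hA ⟨{z | ¬ A.Reach z y}, {z | ¬ A.Reach z x}, hcl y, hcl x, ?_, ?_, ?_⟩
  · exact fun h => (h ▸ Set.mem_univ y : y ∈ {z | ¬ A.Reach z y}) Relation.ReflTransGen.refl
  · exact fun h => (h ▸ Set.mem_univ x : x ∈ {z | ¬ A.Reach z x}) Relation.ReflTransGen.refl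
  have hmem : ∀ (S T : Set V) (z : V),
      z ∈ (Subtype.val : S → V) '' (Set.range (Set.inclusion (Set.inter_subset_left (t := T))))ᶜ →
      z ∉ T := by
    rintro S T _ ⟨z, hz, rfl⟩ hT
    exact hz ⟨⟨z, z.2, hT⟩, rfl⟩
  have hmem' : ∀ (S T : Set V) (z : V),
      z ∈ (Subtype.val : T → V) '' (Set.range (Set.inclusion (Set.inter_subset_right (s := S))))ᶜ →
      z ∉ S := by
    rintro S T _ ⟨z, hz, rfl⟩ hT
    exact hz ⟨⟨z, hT, z.2⟩, rfl⟩
  refine ⟨⟨A.isEmbedding_induce (hcl y), A.isEmbedding_induce (hcl x), rfl⟩, ?_, ?_, ?_, ?_⟩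
  · ext z
    simp only [Subtype.range_coe_subtype, Set.mem_union, Set.mem_ofPred_eq, Set.mem_univ, iff_true]
    by_contra! h
    exact h1 z h.2 h.1
  · rintro ⟨a, ha⟩ ⟨b, hb⟩
    constructor
    · rintro rfl
      exact ⟨⟨a, ha, hb⟩, rfl, rfl⟩
    · rintro ⟨c, hc, hc'⟩
      rw [← hc, ← hc']
  · rintro R t ht ⟨⟨i, hi⟩, j, hj⟩
    exact h2 R t ht i j (not_not.1 (hmem _ _ _ hi)) (not_not.1 (hmem' _ _ _ hj))
  · rintro F t - ⟨⟨i, hi⟩, j, hj⟩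
    obtain ⟨a, rfl⟩ := exists_eq_const hL t
    exact h1 a (not_not.1 (hmem _ _ _ hi)) (not_not.1 (hmem' _ _ _ hj))

/-! ### Partial automorphisms as total functions -/

namespace PartialAut

variable {A : Str L V}

open Classical in
/-- The partial automorphism `p`, extended by the identity outside its domain. -/
noncomputable def toFun (p : A.PartialAut) (x : V) : V :=
  if h : x ∈ p.dom then p.map ⟨x, h⟩ else x

theorem toFun_coe (p : A.PartialAut) (x : p.dom) : p.toFun x = p.map x := by
  simp [toFun]

theorem toFun_mem (p : A.PartialAut) {x : V} (hx : x ∈ p.dom) : p.toFun x ∈ p.ran := by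
  rw [p.toFun_coe ⟨x, hx⟩]
  exact Subtype.coe_prop _

theorem injOn_toFun (p : A.PartialAut) : Set.InjOn p.toFun p.dom := by
  intro x hx y hy h
  rw [p.toFun_coe ⟨x, hx⟩, p.toFun_coe ⟨y, hy⟩] at h
  simpa using p.map.injective (Subtype.ext h)

theorem image_toFun (p : A.PartialAut) : p.toFun '' p.dom = p.ran := by
  ext y
  constructor
  · rintro ⟨x, hx, rfl⟩
    exact p.toFun_mem hx
  · intro hy
    exact ⟨p.map.symm ⟨y, hy⟩, Subtype.coe_prop _, by simp [toFun_coe]⟩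

theorem rel_iff (p : A.PartialAut) {R : L.Rel} {x : Fin (L.arity R) → V}
    (hx : ∀ i, x i ∈ p.dom) : x ∈ A.rel R ↔ p.toFun ∘ x ∈ A.rel R := by
  have h := IsEmbedding.rel_iff p.isIso R fun i => (⟨x i, hx i⟩ : p.dom)
  have e : p.toFun ∘ x = fun i => (p.map ⟨x i, hx i⟩ : V) :=
    funext fun i => p.toFun_coe ⟨x i, hx i⟩
  rw [e]
  exact h

/-- Partial automorphisms are isomorphisms between closed sets of `A`, so they commute with the
functions of `A` itself. -/
theorem fn_image (p : A.PartialAut) {F : L.Func} {x : Fin (L.domArity F) → V}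
    (hx : ∀ i, x i ∈ p.dom) {s : Finset V} (hs : A.fn F x s) :
    ∃ t, A.fn F (p.toFun ∘ x) t ∧ (t : Set V) = p.toFun '' s := by
  have h1 := (A.isEmbedding_induce p.dom_closed).dom_iff F fun i => (⟨x i, hx i⟩ : p.dom)
  obtain ⟨s', hs'⟩ := h1.2 ⟨s, hs⟩
  have h2 := (A.isEmbedding_induce p.dom_closed).fn_map hs'
  have h3 := (A.isEmbedding_induce p.ran_closed).fn_map (IsEmbedding.fn_map p.isIso hs')
  have e : p.toFun ∘ x = fun i => (p.map ⟨x i, hx i⟩ : V) :=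
    funext fun i => p.toFun_coe ⟨x i, hx i⟩
  refine ⟨_, by rw [e]; exact h3, ?_⟩
  rw [A.fn_unique _ _ _ _ hs h2]
  ext y
  simp only [Finset.coe_map, Set.mem_image, Finset.mem_coe]
  constructor
  · rintro ⟨_, ⟨a, ha, rfl⟩, rfl⟩
    exact ⟨a, ⟨a, ha, rfl⟩, p.toFun_coe a⟩
  · rintro ⟨_, ⟨a, ha, rfl⟩, rfl⟩
    exact ⟨_, ⟨a, ha, rfl⟩, (p.toFun_coe a).symm⟩

theorem funDom_of_toFun (p : A.PartialAut) {F : L.Func} {x : Fin (L.domArity F) → V}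
    (hx : ∀ i, x i ∈ p.dom) {t : Finset V} (ht : A.fn F (p.toFun ∘ x) t) :
    ∃ s, A.fn F x s := by
  have e : p.toFun ∘ x = fun i => (p.map ⟨x i, hx i⟩ : V) :=
    funext fun i => p.toFun_coe ⟨x i, hx i⟩
  rw [e] at ht
  obtain ⟨t', ht'⟩ := ((A.isEmbedding_induce p.ran_closed).dom_iff F
    fun i => p.map ⟨x i, hx i⟩).2 ⟨t, ht⟩
  obtain ⟨s', hs'⟩ := (IsEmbedding.dom_iff p.isIso F fun i => (⟨x i, hx i⟩ : p.dom)).2 ⟨t', ht'⟩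
  exact ⟨_, (A.isEmbedding_induce p.dom_closed).fn_map hs'⟩

theorem extendsTo_iff {p : A.PartialAut} {φ : V → W} {g : Equiv.Perm W} :
    p.ExtendsTo φ g ↔ ∀ x ∈ p.dom, g (φ x) = φ (p.toFun x) :=
  ⟨fun h x hx => by rw [p.toFun_coe ⟨x, hx⟩]; exact h ⟨x, hx⟩,
    fun h x => by rw [← p.toFun_coe x]; exact h x x.2⟩

theorem CoherentTriple.toFun_eq {f g h : A.PartialAut} (H : CoherentTriple f g h) {x : V}
    (hx : x ∈ f.dom) : h.toFun x = g.toFun (f.toFun x) := by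
  obtain ⟨h1, h2, -, h4⟩ := H
  rw [h.toFun_coe ⟨x, h1 ▸ hx⟩, g.toFun_coe ⟨f.toFun x, h2 ▸ f.toFun_mem hx⟩]
  exact h4 ⟨x, hx⟩ _ _ rfl (f.toFun_coe ⟨x, hx⟩)

end PartialAut

end Str

/-! ### Coherent extension of partial injections -/

section PermExtension

variable {X ι : Type*} [LinearOrder X] [Finite X]

/-- A permutation is determined by its restriction to a set if it is increasing on the
complement. This is what makes extensions of partial maps coherent. -/
theorem perm_eq_of_strictMonoOn {D : Set X} {σ τ : Equiv.Perm X} (h : Set.EqOn σ τ D)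
    (hσ : StrictMonoOn σ Dᶜ) (hτ : StrictMonoOn τ Dᶜ) : σ = τ := by
  have hD : σ '' D = τ '' D := Set.image_congr h
  have hc : σ '' Dᶜ = τ '' Dᶜ := by
    rw [Set.image_compl_eq σ.bijective, Set.image_compl_eq τ.bijective, hD]
  let e₁ : (Dᶜ : Set X) ≃o (σ '' Dᶜ : Set X) := StrictMonoOn.orderIso σ Dᶜ hσ
  let e₂ : (Dᶜ : Set X) ≃o (τ '' Dᶜ : Set X) := StrictMonoOn.orderIso τ Dᶜ hτ
  let e₃ : (σ '' Dᶜ : Set X) ≃o (τ '' Dᶜ : Set X) := OrderIso.setCongr _ _ hc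
  ext x
  by_cases hx : x ∈ D
  · exact h hx
  · have := congrArg (fun e : (Dᶜ : Set X) ≃o (τ '' Dᶜ : Set X) => (e ⟨x, hx⟩ : X))
      (Subsingleton.elim (e₁.trans e₃) e₂)
    exact this

theorem exists_perm_strictMonoOn (J : Set ι) (a b : ι → X)
    (h : ∀ i ∈ J, ∀ j ∈ J, a i = a j ↔ b i = b j) :
    ∃ σ : Equiv.Perm X, (∀ i ∈ J, σ (a i) = b i) ∧ StrictMonoOn σ (a '' J)ᶜ := by
  classical
  have := Fintype.ofFinite X
  have hex : ∀ x : (a '' J : Set X), ∃ i ∈ J, a i = x := fun x => x.2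
  choose c hcJ hc using hex
  let f : (a '' J : Set X) → (b '' J : Set X) := fun x => ⟨b (c x), _, hcJ x, rfl⟩
  have hfa : ∀ i (hi : i ∈ J), (f ⟨a i, i, hi, rfl⟩ : X) = b i := fun i hi =>
    (h _ (hcJ _) i hi).1 (hc _)
  have hf : Function.Bijective f := by
    constructor
    · intro x y hxy
      have := (h _ (hcJ x) _ (hcJ y)).2 (congrArg Subtype.val hxy)
      rw [hc, hc] at this
      exact Subtype.ext this
    · rintro ⟨_, i, hi, rfl⟩
      exact ⟨⟨a i, i, hi, rfl⟩, Subtype.ext (hfa i hi)⟩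
  let e := Equiv.ofBijective f hf
  have hcard : Fintype.card ((a '' J)ᶜ : Set X) = Fintype.card ((b '' J)ᶜ : Set X) := by
    rw [Fintype.card_compl_set, Fintype.card_compl_set, Fintype.card_congr e]
  let o : ((a '' J)ᶜ : Set X) ≃o ((b '' J)ᶜ : Set X) :=
    (Fintype.orderIsoFinOfCardEq _ hcard).symm.trans (Fintype.orderIsoFinOfCardEq _ rfl)
  let σ : Equiv.Perm X :=
    ((Equiv.Set.sumCompl (a '' J)).symm.trans (Equiv.sumCongr e o.toEquiv)).trans
      (Equiv.Set.sumCompl (b '' J))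
  refine ⟨σ, fun i hi => ?_, ?_⟩
  · have hm : a i ∈ a '' J := ⟨i, hi, rfl⟩
    simp only [σ, Equiv.trans_apply, Equiv.Set.sumCompl_symm_apply_of_mem hm, Equiv.sumCongr_apply,
      Sum.map_inl, Equiv.Set.sumCompl_apply_inl]
    exact hfa i hi
  · intro x hx y hy hxy
    simp only [σ, Equiv.trans_apply, Equiv.Set.sumCompl_symm_apply_of_notMem hx,
      Equiv.Set.sumCompl_symm_apply_of_notMem hy, Equiv.sumCongr_apply,
      Sum.map_inr, Equiv.Set.sumCompl_apply_inr]
    exact o.strictMono (show (⟨x, hx⟩ : ((a '' J)ᶜ : Set X)) < ⟨y, hy⟩ from hxy)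

end PermExtension

end PLanguage

namespace PLanguage

namespace Str

variable {L : PLanguage.{u, v}} {U V W : Type w}

/-! ### Extending the relations: parity valuations -/

section Parity

/-- Indices of parity valuations. A tuple `t` of vertices of `A` and a relation symbol `R` give
the index consisting of the set of permutations `s` with `R(s ∘ t)` and of the range of `t`;
thus only finitely many indices are needed, even in an infinite language. -/
abbrev ParityIndex (V : Type w) : Type w := Set (Equiv.Perm V) × Finset V

/-- The action of permutations on indices; it takes the index of `t` to the index of `g ∘ t`. -/
def ParityIndex.act (g : Equiv.Perm V) (q : ParityIndex V) : ParityIndex V :=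
  ({s | s * g ∈ q.1}, q.2.map g.toEmbedding)

theorem ParityIndex.act_mul (g f : Equiv.Perm V) (q : ParityIndex V) :
    act (g * f) q = act g (act f q) := by
  refine Prod.ext (Set.ext fun s => ?_) ?_
  · simp [act, mul_assoc]
  · exact (Finset.map_map f.toEmbedding g.toEmbedding q.2).symm

theorem ParityIndex.act_inv_act (g : Equiv.Perm V) (q : ParityIndex V) :
    act g⁻¹ (act g q) = q := by
  rw [← act_mul, inv_mul_cancel]
  refine Prod.ext (Set.ext fun s => ?_) ?_
  · simp [act]
  · exact Finset.map_refl

open Classical in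
/-- The element of `ℤ/2` that vanishes exactly when `P` holds. -/
noncomputable def parity (P : Prop) : ZMod 2 := if P then 0 else 1

/-- The change of parity of a tuple when `g` is applied to it. -/
noncomputable def defect (g : Equiv.Perm V) (q : ParityIndex V) : ZMod 2 :=
  parity (1 ∈ q.1) + parity (g ∈ q.1)

theorem defect_mul (g f : Equiv.Perm V) (q : ParityIndex V) :
    defect (g * f) q = defect f q + defect g (q.act f) := by
  have : ∀ a b c : ZMod 2, a + c = a + b + (b + c) := by decide
  simp only [defect, ParityIndex.act, Set.mem_ofPred_eq, one_mul]
  exact this _ _ _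

/-- The map on valued vertices that applies `g` and then changes the valuations by `c`. -/
def valuationMove (g : Equiv.Perm V) (c : ParityIndex V → V → ZMod 2)
    (a : V × (ParityIndex V → ZMod 2)) : V × (ParityIndex V → ZMod 2) :=
  (g a.1, fun q => a.2 (q.act g⁻¹) + c (q.act g⁻¹) a.1)

theorem valuationMove_injective (g : Equiv.Perm V) (c : ParityIndex V → V → ZMod 2) :
    Function.Injective (valuationMove g c) := by
  rintro ⟨x, a⟩ ⟨y, b⟩ h
  obtain ⟨h1, h2⟩ := Prod.ext_iff.1 h
  obtain rfl : x = y := g.injective h1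
  refine Prod.ext rfl (funext fun q => ?_)
  have := congrFun h2 (q.act g)
  simpa [valuationMove, ParityIndex.act_inv_act] using this

variable [DecidableEq V]

/-- The index of the tuple `t` with respect to the relation symbol `R`. -/
def tupleIndex (A : Str L V) (R : L.Rel) (t : Fin (L.arity R) → V) : ParityIndex V :=
  ({s | s ∘ t ∈ A.rel R}, Finset.univ.image t)

theorem act_tupleIndex (A : Str L V) (R : L.Rel) (t : Fin (L.arity R) → V) (g : Equiv.Perm V) :
    (A.tupleIndex R t).act g = A.tupleIndex R (g ∘ t) := by
  refine Prod.ext rfl ?_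
  simp only [ParityIndex.act, tupleIndex, Finset.map_eq_image, Finset.image_image]
  rfl

/-- A tuple of valued vertices is in the relation if the sum of its valuations at its own index
is even or odd according to whether its projection to `A` is in the relation or not. The function
`c` records the valuations by base points, so that repeated entries are counted once. -/
def parityRel (A : Str L V) (R : L.Rel) :
    Set (Fin (L.arity R) → V × (ParityIndex V → ZMod 2)) :=
  {t | ∃ c : V → ZMod 2, (∀ i, c (t i).1 = (t i).2 (A.tupleIndex R (Prod.fst ∘ t))) ∧
    ∑ x ∈ (A.tupleIndex R (Prod.fst ∘ t)).2, c x = parity (Prod.fst ∘ t ∈ A.rel R)}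

theorem zero_mem_parityRel (A : Str L V) (R : L.Rel) (t : Fin (L.arity R) → V) :
    (fun i => (t i, 0)) ∈ A.parityRel R ↔ t ∈ A.rel R := by
  have e : Prod.fst ∘ (fun i => (t i, (0 : ParityIndex V → ZMod 2))) = t := rfl
  unfold parityRel
  rw [Set.mem_ofPred_eq, e]
  constructor
  · rintro ⟨c, h1, h2⟩
    rw [Finset.sum_eq_zero fun x hx => ?_] at h2
    · by_contra h
      simp [parity, h] at h2
    · obtain ⟨i, -, rfl⟩ := Finset.mem_image.1 hx
      exact h1 i
  · intro h
    exact ⟨0, fun i => rfl, by simp [parity, h]⟩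

theorem valuationMove_mem_parityRel {A : Str L V} {R : L.Rel} {g : Equiv.Perm V}
    {c : ParityIndex V → V → ZMod 2}
    (hc : ∀ t : Fin (L.arity R) → V, ∑ x ∈ (A.tupleIndex R t).2, c (A.tupleIndex R t) x =
      defect g (A.tupleIndex R t)) (t : Fin (L.arity R) → V × (ParityIndex V → ZMod 2)) :
    t ∈ A.parityRel R ↔ valuationMove g c ∘ t ∈ A.parityRel R := by
  set t₀ : Fin (L.arity R) → V := Prod.fst ∘ t with ht₀
  have e : Prod.fst ∘ (valuationMove g c ∘ t) = g ∘ t₀ := rfl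
  have hd := hc t₀
  have hval : ∀ i, ((valuationMove g c ∘ t) i).2 (A.tupleIndex R (g ∘ t₀)) =
      (t i).2 (A.tupleIndex R t₀) + c (A.tupleIndex R t₀) (t₀ i) := by
    intro i
    simp only [valuationMove, Function.comp_apply, ← act_tupleIndex, ParityIndex.act_inv_act, ht₀]
  have hsum : ∀ f : V → ZMod 2, ∑ x ∈ (A.tupleIndex R (g ∘ t₀)).2, f x =
      ∑ x ∈ (A.tupleIndex R t₀).2, f (g x) := by
    intro f
    rw [← act_tupleIndex]
    simp [ParityIndex.act]
  have hdef : defect g (A.tupleIndex R t₀) =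
      parity (t₀ ∈ A.rel R) + parity (g ∘ t₀ ∈ A.rel R) := rfl
  have h2 : ∀ a b : ZMod 2, a + (a + b) = b := by decide
  have h3 : ∀ a b : ZMod 2, b + (a + b) = a := by decide
  unfold parityRel
  rw [Set.mem_ofPred_eq, Set.mem_ofPred_eq, e, ← ht₀]
  simp only [hval, hsum]
  constructor
  · rintro ⟨f, hf, hs⟩
    refine ⟨fun y => f (g.symm y) + c (A.tupleIndex R t₀) (g.symm y), fun i => ?_, ?_⟩
    · rw [← hf]
      simp [valuationMove, ht₀]
    · simp only [Equiv.symm_apply_apply, Finset.sum_add_distrib]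
      rw [hs, hd, hdef, h2]
  · rintro ⟨f, hf, hs⟩
    refine ⟨fun x => f (g x) + c (A.tupleIndex R t₀) x, fun i => ?_, ?_⟩
    · have := hf i
      simp only [valuationMove, Function.comp_apply] at this
      change f (g (t i).1) + _ = _
      rw [this]
      have h4 : ∀ a b : ZMod 2, a + b + b = a := by decide
      exact h4 _ _
    · simp only [Finset.sum_add_distrib]
      rw [hs, hd, hdef, h3]

end Parity

section ParityExtension

variable [LinearOrder V]

open Classical in
/-- The change of valuations along a partial automorphism with domain `D` that is extended to the
permutation `g`: the whole defect is charged to the least vertex outside of `D`. -/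
noncomputable def repair (D : Set V) (g : Equiv.Perm V) (q : ParityIndex V) (x : V) : ZMod 2 :=
  if x ∈ q.2 ∧ x ∉ D ∧ ∀ y ∈ q.2, y ∉ D → x ≤ y then defect g q else 0

theorem sum_repair (D : Set V) (g : Equiv.Perm V) (q : ParityIndex V)
    (h : (∀ x ∈ q.2, x ∈ D) → defect g q = 0) : ∑ x ∈ q.2, repair D g q x = defect g q := by
  classical
  by_cases hq : ∀ x ∈ q.2, x ∈ D
  · rw [h hq]
    refine Finset.sum_eq_zero fun x hx => ?_
    rw [repair, if_neg]
    exact fun h => h.2.1 (hq x h.1)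
  · push Not at hq
    obtain ⟨m, hm, hmin⟩ := (q.2.filter (· ∉ D)).exists_min_image id
      (by simpa [Finset.filter_nonempty_iff] using hq)
    rw [Finset.mem_filter] at hm
    have hmin' : ∀ y ∈ q.2, y ∉ D → m ≤ y := fun y hy hyD => hmin y (by simp [hy, hyD])
    rw [Finset.sum_eq_single m]
    · rw [repair, if_pos ⟨hm.1, hm.2, hmin'⟩]
    · intro x _ hxm
      rw [repair, if_neg]
      exact fun h => hxm (le_antisymm (h.2.2 m hm.1 hm.2) (hmin' x h.1 h.2.1))
    · exact fun h => (h hm.1).elim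

theorem repair_mul {D E : Set V} {f g : Equiv.Perm V} (hf : StrictMonoOn f Dᶜ)
    (hE : ∀ x, f x ∈ E ↔ x ∈ D) (q : ParityIndex V) (x : V) :
    repair D (g * f) q x = repair D f q x + repair E g (q.act f) (f x) := by
  have hiff : (f x ∈ (q.act f).2 ∧ f x ∉ E ∧ ∀ y ∈ (q.act f).2, y ∉ E → f x ≤ y) ↔
      (x ∈ q.2 ∧ x ∉ D ∧ ∀ y ∈ q.2, y ∉ D → x ≤ y) := by
    simp only [ParityIndex.act, Finset.mem_map_equiv, Equiv.symm_apply_apply, hE]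
    refine and_congr_right fun _ => and_congr_right fun hx => ⟨fun h y hy hyD => ?_, ?_⟩
    · exact (hf.le_iff_le hx hyD).1 (h (f y) (by simpa using hy) (by simpa [hE] using hyD))
    · intro h y hy hyE
      obtain ⟨y, rfl⟩ := f.surjective y
      rw [hE] at hyE
      exact (hf.le_iff_le hx hyE).2 (h y (by simpa using hy) hyE)
  by_cases h : x ∈ q.2 ∧ x ∉ D ∧ ∀ y ∈ q.2, y ∉ D → x ≤ y
  · rw [repair, repair, repair, if_pos h, if_pos h, if_pos (hiff.2 h), defect_mul]
  · rw [repair, repair, repair, if_neg h, if_neg h, if_neg (hiff.not.2 h), add_zero]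

theorem valuationMove_repair_mul {D E : Set V} {f g : Equiv.Perm V} (hf : StrictMonoOn f Dᶜ)
    (hE : ∀ x, f x ∈ E ↔ x ∈ D) :
    valuationMove (g * f) (repair D (g * f)) =
      valuationMove g (repair E g) ∘ valuationMove f (repair D f) := by
  funext a
  refine Prod.ext rfl (funext fun q => ?_)
  obtain ⟨q, rfl⟩ : ∃ q', q = ParityIndex.act (g * f) q' :=
    ⟨q.act (g * f)⁻¹, by simpa using (ParityIndex.act_inv_act (g * f)⁻¹ q).symm⟩
  have h1 : (q.act (g * f)).act g⁻¹ = q.act f := by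
    rw [ParityIndex.act_mul, ParityIndex.act_inv_act]
  simp only [valuationMove, Function.comp_apply, ParityIndex.act_inv_act, h1, repair_mul hf hE]
  ring

end ParityExtension

/-- The relational part of the extension property: partial automorphisms of `A` extend
coherently to permutations that preserve the relations of a finite superset of `A`. -/
theorem exists_relational_extension [Finite V] (A : Str L V) :
    ∃ (X : Type w) (_ : Finite X) (rel : ∀ R : L.Rel, Set (Fin (L.arity R) → X)) (φ : V → X)
      (ext : A.PartialAut → Equiv.Perm X), Function.Injective φ ∧
      (∀ R x, x ∈ A.rel R ↔ φ ∘ x ∈ rel R) ∧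
      (∀ p R t, t ∈ rel R ↔ ext p ∘ t ∈ rel R) ∧
      (∀ p : A.PartialAut, ∀ x ∈ p.dom, ext p (φ x) = φ (p.toFun x)) ∧
      ∀ f g h, PartialAut.CoherentTriple f g h → ext h = ext g * ext f := by
  classical
  let _ : LinearOrder V := IsWellOrder.linearOrder WellOrderingRel
  have hex : ∀ p : A.PartialAut, ∃ σ : Equiv.Perm V, (∀ x ∈ p.dom, σ x = p.toFun x) ∧
      StrictMonoOn σ p.domᶜ := fun p => by
    simpa using exists_perm_strictMonoOn p.dom id p.toFun
      fun x hx y hy => (p.injOn_toFun.eq_iff hx hy).symm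
  choose σ hσ hmono using hex
  have hran : ∀ p x, σ p x ∈ p.ran ↔ x ∈ p.dom := by
    intro p x
    rw [← p.image_toFun, ← Set.image_congr (hσ p), (σ p).injective.mem_set_image]
  let T : A.PartialAut → Equiv.Perm (V × (ParityIndex V → ZMod 2)) := fun p =>
    Equiv.ofBijective (valuationMove (σ p) (repair p.dom (σ p)))
      (Finite.injective_iff_bijective.1 (valuationMove_injective _ _))
  refine ⟨V × (ParityIndex V → ZMod 2), inferInstance, A.parityRel, fun x => (x, 0), T,
    fun x y h => congrArg Prod.fst h, fun R x => (zero_mem_parityRel A R x).symm,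
    fun p R t => ?_, fun p x hx => ?_, fun f g h H => ?_⟩
  · refine valuationMove_mem_parityRel (fun t => sum_repair _ _ _ fun ht => ?_) t
    have htd : ∀ i, t i ∈ p.dom := fun i => ht _ (by simp [tupleIndex])
    have h1 : σ p ∘ t = p.toFun ∘ t := funext fun i => hσ p _ (htd i)
    have h2 : t ∈ A.rel R ↔ σ p ∘ t ∈ A.rel R := by rw [h1]; exact p.rel_iff htd
    have h3 : ∀ a : ZMod 2, a + a = 0 := by decide
    change parity (t ∈ A.rel R) + parity (σ p ∘ t ∈ A.rel R) = 0
    rw [propext h2, h3]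
  · refine Prod.ext (hσ p x hx) (funext fun q => ?_)
    change 0 + repair p.dom (σ p) _ x = 0
    rw [repair, if_neg fun h => h.2.1 hx, zero_add]
  · have hE : ∀ x, σ f x ∈ g.dom ↔ x ∈ f.dom := H.2.1 ▸ hran f
    have hmul : σ h = σ g * σ f := by
      refine perm_eq_of_strictMonoOn (D := h.dom) (fun x hx => ?_) (hmono h) ?_
      · have hx' : x ∈ f.dom := H.1 ▸ hx
        rw [hσ h x hx, H.toFun_eq hx', Equiv.Perm.mul_apply, hσ f x hx', hσ g]
        exact H.2.1 ▸ f.toFun_mem hx'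
      · rw [← H.1]
        exact (hmono g).comp (hmono f) fun x hx hx' => hx ((hE x).1 hx')
    ext1 a
    have := congrFun (valuationMove_repair_mul (g := σ g) (hmono f) hE) a
    rw [← hmul] at this
    change valuationMove (σ h) (repair h.dom (σ h)) a = _
    rw [← H.1, this]
    rfl

end Str

end PLanguage

namespace PLanguage

/-! ### Structures whose unary functions are lifted along a projection -/

/-- Data for a structure on `W` over a set `X`. The functions are first given with values in `X`:
`val F w t` says that the value of `F` at `w` is to lie over `t`. The relation `le w' w` selects
the vertices `w'` that may belong to values at `w`; there is at most one over each point. -/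
structure Cover (L : PLanguage.{u, v}) (W X : Type w) where
  rel : (R : L.Rel) → Set (Fin (L.arity R) → W)
  proj : W → X
  le : W → W → Prop
  val : L.Func → W → Finset X → Prop
  val_unique : ∀ F w s t, val F w s → val F w t → s = t
  val_card : ∀ F w s, val F w s → s.card = L.ranArity F
  exists_le : ∀ F w s, val F w s → ∀ y ∈ s, ∃ w', le w' w ∧ proj w' = y
  le_unique : ∀ w w₁ w₂, le w₁ w → le w₂ w → proj w₁ = proj w₂ → w₁ = w₂

namespace Cover

open Str

variable {L : PLanguage.{u, v}} {V W X : Type w} (hL : ∀ F : L.Func, L.domArity F = 1)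

/-- The structure on `W` whose value `F(w)` consists of the vertices `w'` with `le w' w` that lie
over the prescribed subset of `X`. -/
def toStr (C : Cover L W X) : Str L W where
  rel := C.rel
  fn F x s := ∃ w t, x = (fun _ => w) ∧ C.val F w t ∧ ∀ w', w' ∈ s ↔ C.le w' w ∧ C.proj w' ∈ t
  fn_unique F x s s' := by
    rintro ⟨w, t, rfl, ht, hs⟩ ⟨w', t', hw, ht', hs'⟩
    obtain rfl := const_injective hL F hw
    obtain rfl := C.val_unique F w t t' ht ht'
    ext a
    rw [hs, hs']
  fn_card F x s := by
    classical
    rintro ⟨w, t, rfl, ht, hs⟩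
    rw [← C.val_card F w t ht, ← Finset.card_image_of_injOn (f := C.proj) (s := s)]
    · congr 1
      ext y
      simp only [Finset.mem_image, hs]
      constructor
      · rintro ⟨a, ha, rfl⟩
        exact ha.2
      · intro hy
        obtain ⟨w', hw', rfl⟩ := C.exists_le F w t ht y hy
        exact ⟨w', ⟨hw', hy⟩, rfl⟩
    · intro a ha b hb hab
      exact C.le_unique w a b ((hs a).1 ha).1 ((hs b).1 hb).1 hab

theorem exists_fn [Finite W] (C : Cover L W X) {F : L.Func} {w : W} {t : Finset X}
    (ht : C.val F w t) : ∃ s, (C.toStr hL).fn F (fun _ => w) s :=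
  ⟨(Set.toFinite {w' | C.le w' w ∧ C.proj w' ∈ t}).toFinset, w, t, rfl, ht, by simp⟩

theorem le_of_arrow {C : Cover L W X} {w w' : W} (h : (C.toStr hL).Arrow w w') : C.le w' w := by
  obtain ⟨F, s, ⟨a, t, ha, -, hs⟩, hw⟩ := h
  obtain rfl := const_injective hL F ha
  exact ((hs w').1 hw).1

theorem isAut_toStr [Finite W] {C : Cover L W X} {g : Equiv.Perm W} {γ : X ↪ X}
    (proj : ∀ w, C.proj (g w) = γ (C.proj w)) (le : ∀ w w', C.le w' w → C.le (g w') (g w))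
    (val : ∀ F w t, C.val F w t → C.val F (g w) (t.map γ))
    (dom : ∀ F w t, C.val F (g w) t → ∃ s, C.val F w s)
    (rel : ∀ R t, t ∈ C.rel R ↔ g ∘ t ∈ C.rel R) : (C.toStr hL).IsAut g := by
  refine isEmbedding_of_fn_map g.injective rel ?_ ?_
  · rintro F x s ⟨w, t, rfl, ht, hs⟩
    refine ⟨g w, t.map γ, rfl, val F w t ht, fun a => ?_⟩
    obtain ⟨a, rfl⟩ := g.surjective a
    rw [proj]
    have h1 : g a ∈ s.map ⟨g, g.injective⟩ ↔ a ∈ s := Finset.mem_map' ⟨g, g.injective⟩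
    rw [h1, Finset.mem_map', hs]
    refine ⟨fun h => ⟨le _ _ h.1, h.2⟩, fun h => ⟨?_, h.2⟩⟩
    -- `g` reflects `le` because there is a vertex below `w` over the same point as `a`
    obtain ⟨b, hb, hba⟩ := C.exists_le F w t ht _ h.2
    have := C.le_unique _ _ _ h.1 (le _ _ hb) (by rw [proj, proj, hba])
    rwa [g.injective this]
  · rintro F x s ⟨w, t, hx, ht, -⟩
    obtain ⟨a, rfl⟩ := exists_eq_const hL x
    obtain rfl : g a = w := const_injective hL F hx
    obtain ⟨s', hs'⟩ := dom F a t ht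
    exact C.exists_fn hL hs'

theorem isEmbedding_toStr {A : Str L V} {C : Cover L W X} {φ : V → W} {φ₀ : V ↪ X}
    (proj : ∀ v, C.proj (φ v) = φ₀ v) (le : ∀ v v', A.Arrow v v' → C.le (φ v') (φ v))
    (val : ∀ F v s, A.fn F (fun _ => v) s → C.val F (φ v) (s.map φ₀))
    (dom : ∀ F v t, C.val F (φ v) t → ∃ s, A.fn F (fun _ => v) s)
    (rel : ∀ R t, t ∈ A.rel R ↔ φ ∘ t ∈ C.rel R) : IsEmbedding A (C.toStr hL) φ := by
  have hinj : Function.Injective φ := fun a b h =>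
    φ₀.injective (by rw [← proj, ← proj, h])
  refine isEmbedding_of_fn_map hinj rel ?_ ?_
  · rintro F x s hs
    obtain ⟨v, rfl⟩ := exists_eq_const hL x
    refine ⟨φ v, s.map φ₀, rfl, val F v s hs, fun a => ?_⟩
    simp only [Finset.mem_map, Function.Embedding.coeFn_mk]
    constructor
    · rintro ⟨b, hb, rfl⟩
      exact ⟨le v b ⟨F, s, hs, hb⟩, b, hb, (proj b).symm⟩
    · rintro ⟨ha, b, hb, hba⟩
      exact ⟨b, hb, C.le_unique _ _ _ (le v b ⟨F, s, hs, hb⟩) ha (by rw [proj, hba])⟩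
  · rintro F x s ⟨w, t, hx, ht, -⟩
    obtain ⟨a, rfl⟩ := exists_eq_const hL x
    obtain rfl : φ a = w := const_injective hL F hx
    exact dom F a t ht

end Cover

namespace Str

variable {L : PLanguage.{u, v}} {U V W X Y : Type w}

/-! ### Extending the functions: vertices that carry their closure -/

theorem eq_of_rel_of_fn {A B : Str L V} (h : A.rel = B.rel)
    (h' : ∀ F x s, A.fn F x s ↔ B.fn F x s) : A = B := by
  cases A
  cases B
  obtain rfl := h
  have := funext fun F => funext fun x => funext fun s => propext (h' F x s)
  simp only at this
  subst this
  rfl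

/-- The image of the functions of `A` under an injective map; relations are forgotten. -/
def push (m : V ↪ X) (A : Str L V) : Str L X where
  rel _ := ∅
  fn F x s := ∃ x₀ s₀, A.fn F x₀ s₀ ∧ x = m ∘ x₀ ∧ s = s₀.map m
  fn_unique F x s t := by
    rintro ⟨x₀, s₀, h, rfl, rfl⟩ ⟨x₁, s₁, h', hx, rfl⟩
    rw [m.injective.comp_left hx] at h
    rw [A.fn_unique F _ _ _ h h']
  fn_card F x s := by
    rintro ⟨x₀, s₀, h, -, rfl⟩
    rw [Finset.card_map, A.fn_card F _ _ h]

/-- The functions of `S` restricted to the vertices reachable from `y`, on the same underlying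
set; relations are forgotten. -/
def below (S : Str L X) (y : X) : Str L X where
  rel _ := ∅
  fn F x s := S.fn F x s ∧ ∀ i, S.Reach y (x i)
  fn_unique F x s t hs ht := S.fn_unique F x s t hs.1 ht.1
  fn_card F x s hs := S.fn_card F x s hs.1

theorem push_push (m : V ↪ X) (σ : X ↪ Y) (A : Str L V) :
    push σ (push m A) = push (m.trans σ) A := by
  refine eq_of_rel_of_fn rfl fun F x s => ?_
  constructor
  · rintro ⟨_, _, ⟨x, s, h, rfl, rfl⟩, rfl, rfl⟩
    exact ⟨x, s, h, rfl, Finset.map_map _ _ _⟩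
  · rintro ⟨x, s, h, rfl, rfl⟩
    exact ⟨_, _, ⟨x, s, h, rfl, rfl⟩, rfl, (Finset.map_map _ _ _).symm⟩

theorem push_fn_iff {m : V ↪ X} {A : Str L V} {F : L.Func} {v : V} {t : Finset X} :
    (push m A).fn F (fun _ => m v) t ↔ ∃ s, A.fn F (fun _ => v) s ∧ t = s.map m := by
  constructor
  · rintro ⟨x, s, h, hx, rfl⟩
    have : (fun _ => v) = x := m.injective.comp_left hx
    exact ⟨s, this ▸ h, rfl⟩
  · rintro ⟨s, h, rfl⟩
    exact ⟨_, s, h, rfl, rfl⟩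

theorem push_arrow {m : V ↪ X} {A : Str L V} {v : V} {b : X} :
    (push m A).Arrow (m v) b ↔ ∃ v', A.Arrow v v' ∧ b = m v' := by
  constructor
  · rintro ⟨F, t, ht, hb⟩
    obtain ⟨s, hs, rfl⟩ := push_fn_iff.1 ht
    obtain ⟨v', hv', rfl⟩ := Finset.mem_map.1 hb
    exact ⟨v', ⟨F, s, hs, hv'⟩, rfl⟩
  · rintro ⟨v', ⟨F, s, hs, hv'⟩, rfl⟩
    exact ⟨F, _, push_fn_iff.2 ⟨s, hs, rfl⟩, Finset.mem_map_of_mem m hv'⟩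

theorem push_reach {m : V ↪ X} {A : Str L V} {v : V} {b : X} :
    (push m A).Reach (m v) b ↔ ∃ v', A.Reach v v' ∧ b = m v' := by
  constructor
  · intro h
    induction h with
    | refl => exact ⟨v, Relation.ReflTransGen.refl, rfl⟩
    | tail _ h ih =>
      obtain ⟨v', hv', rfl⟩ := ih
      obtain ⟨v'', hv'', rfl⟩ := push_arrow.1 h
      exact ⟨v'', hv'.tail hv'', rfl⟩
  · rintro ⟨v', h, rfl⟩
    exact Relation.ReflTransGen.lift m (fun a b h => push_arrow.2 ⟨b, h, rfl⟩) _ _ h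

theorem push_below (σ : X ↪ Y) (S : Str L X) (y : X) :
    push σ (below S y) = below (push σ S) (σ y) := by
  refine eq_of_rel_of_fn rfl fun F x s => ?_
  constructor
  · rintro ⟨x, s, ⟨h, hr⟩, rfl, rfl⟩
    exact ⟨⟨x, s, h, rfl, rfl⟩, fun i => push_reach.2 ⟨_, hr i, rfl⟩⟩
  · rintro ⟨⟨x, s, h, rfl, rfl⟩, hr⟩
    refine ⟨x, s, ⟨h, fun i => ?_⟩, rfl, rfl⟩
    obtain ⟨a, ha, hax⟩ := push_reach.1 (hr i)
    rwa [σ.injective hax]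

theorem below_fn_self {S : Str L X} {y : X} {F : L.Func} {t : Finset X} :
    (below S y).fn F (fun _ => y) t ↔ S.fn F (fun _ => y) t :=
  ⟨fun h => h.1, fun h => ⟨h, fun _ => Relation.ReflTransGen.refl⟩⟩

/-- Functions that agree on a closed set of `S` have the same restriction below its elements. -/
theorem below_congr (hL : ∀ F : L.Func, L.domArity F = 1) {S T : Str L X} {Z : Set X}
    (hZ : S.IsClosed Z) (h : ∀ z ∈ Z, ∀ F t, S.fn F (fun _ => z) t ↔ T.fn F (fun _ => z) t)
    {y : X} (hy : y ∈ Z) : below S y = below T y := by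
  have harrow : ∀ a ∈ Z, ∀ b, S.Arrow a b ↔ T.Arrow a b := fun a ha b =>
    exists_congr fun F => exists_congr fun s => and_congr_left fun _ => h a ha F s
  have hreach : ∀ a, S.Reach y a ↔ T.Reach y a := by
    intro a
    constructor
    · intro hr
      induction hr with
      | refl => exact Relation.ReflTransGen.refl
      | tail hr h ih =>
        exact ih.tail ((harrow _ (Reach.mem_of_isClosed hZ hr hy) _).1 h)
    · intro hr
      induction hr with
      | refl => exact Relation.ReflTransGen.refl
      | tail _ h ih =>
        exact ih.tail ((harrow _ (Reach.mem_of_isClosed hZ ih hy) _).2 h)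
  refine eq_of_rel_of_fn rfl fun F x s => ?_
  obtain ⟨a, rfl⟩ := exists_eq_const hL x
  have i₀ : Fin (L.domArity F) := ⟨0, by simp [hL]⟩
  constructor
  · rintro ⟨h1, h2⟩
    exact ⟨(h a (Reach.mem_of_isClosed hZ (h2 i₀) hy) F s).1 h1, fun i => (hreach _).1 (h2 i)⟩
  · rintro ⟨h1, h2⟩
    have h3 : S.Reach y a := (hreach _).2 (h2 i₀)
    exact ⟨(h a (Reach.mem_of_isClosed hZ h3 hy) F s).2 h1, fun i => h3⟩

theorem isClosed_reach (hL : ∀ F : L.Func, L.domArity F = 1) (S : Str L X) (y : X) :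
    S.IsClosed {z | S.Reach y z} :=
  isClosed_of_arrow hL fun _ _ h hr => Relation.ReflTransGen.tail hr h

theorem below_below (hL : ∀ F : L.Func, L.domArity F = 1) {S : Str L X} {y z : X}
    (h : S.Reach y z) : below (below S y) z = below S z :=
  (below_congr hL (S := S) (T := below S y) (isClosed_reach hL S y)
    (fun _ ha _ _ => ⟨fun hs => ⟨hs, fun _ => ha⟩, fun hs => hs.1⟩) h).symm

/-- The vertex of the extension that stands for the vertex `m v` of the copy of `A` under `m`,
together with the functions on its closure. -/
def closureCode (A : Str L V) (m : V ↪ X) (v : V) : X × Str L X :=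
  (m v, below (push m A) (m v))

/-- The action of injective maps on vertices that carry their closure. -/
def pushCode (σ : X ↪ Y) (c : X × Str L X) : Y × Str L Y := (σ c.1, push σ c.2)

theorem pushCode_closureCode (A : Str L V) (m : V ↪ X) (σ : X ↪ Y) (v : V) :
    pushCode σ (closureCode A m v) = closureCode A (m.trans σ) v := by
  simp only [pushCode, closureCode, push_below, push_push]
  rfl

theorem pushCode_pushCode (m : V ↪ X) (σ : X ↪ Y) (c : V × Str L V) :
    pushCode σ (pushCode m c) = pushCode (m.trans σ) c := by
  simp only [pushCode, push_push]
  rfl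

/-- The copies of `A` under `φ` and under `φ` followed by an extension of a partial automorphism
`p` have the same functions on the range of `p`. -/
theorem closureCode_trans_of_extends (hL : ∀ F : L.Func, L.domArity F = 1) {A : Str L V}
    {φ : V ↪ X} {σ : X ↪ X} {p : A.PartialAut} (h : ∀ x ∈ p.dom, σ (φ x) = φ (p.toFun x))
    {x : V} (hx : x ∈ p.dom) : closureCode A (φ.trans σ) x = closureCode A φ (p.toFun x) := by
  have e : ∀ x ∈ p.dom, (φ.trans σ) x = φ (p.toFun x) := h
  unfold closureCode
  rw [e x hx]
  refine Prod.ext rfl (below_congr hL (Z := (φ.trans σ) '' p.dom) ?_ ?_ ⟨x, hx, e x hx⟩)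
  · refine isClosed_of_arrow hL ?_
    rintro _ b hab ⟨a, ha, rfl⟩
    obtain ⟨b, hb, rfl⟩ := push_arrow.1 hab
    exact ⟨b, Reach.mem_of_isClosed p.dom_closed (Relation.ReflTransGen.single hb) ha, rfl⟩
  · rintro _ ⟨a, ha, rfl⟩ F t
    have hmap : ∀ s s' : Finset V, A.fn F (fun _ => a) s → (s' : Set V) = p.toFun '' s →
        s.map (φ.trans σ) = s'.map φ := by
      intro s s' hs hs'
      apply Finset.coe_injective
      rw [Finset.coe_map, Finset.coe_map, hs', Set.image_image]
      exact Set.image_congr fun b hb => e b (p.dom_closed F _ s (fun _ => ha) hs hb)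
    rw [push_fn_iff, e a ha, push_fn_iff]
    constructor
    · rintro ⟨s, hs, rfl⟩
      obtain ⟨s', hs', hss'⟩ := p.fn_image (fun _ => ha) hs
      exact ⟨s', hs', hmap s s' hs hss'⟩
    · rintro ⟨s', hs', rfl⟩
      obtain ⟨s, hs⟩ := p.funDom_of_toFun (fun _ => ha) hs'
      obtain ⟨s'', hs'', hss''⟩ := p.fn_image (fun _ => ha) hs
      obtain rfl := A.fn_unique F _ _ _ hs' hs''
      exact ⟨s, hs, (hmap s s' hs hss'').symm⟩

theorem exists_injective_range_eq {P : Type*} {S : Set P} (hS : S.Finite) :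
    ∃ (W : Type w) (_ : Finite W) (c : W → P), Function.Injective c ∧ Set.range c = S := by
  have : Finite S := hS
  let e : Shrink.{w} S ≃ S := (equivShrink.{w} S).symm
  refine ⟨Shrink.{w} S, inferInstance, Subtype.val ∘ e, Subtype.val_injective.comp e.injective, ?_⟩
  rw [e.surjective.range_comp, Subtype.range_coe]

/-- Finite structures with unary functions have finite coherent EPPA-extensions. -/
theorem exists_isCoherentEPPAExtension (hL : ∀ F : L.Func, L.domArity F = 1) [Finite V]
    (A : Str L V) : ∃ (W : Type w) (_ : Finite W) (B : Str L W) (φ : V → W),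
      IsCoherentEPPAExtension A B φ := by
  obtain ⟨X, _, rel, φ₀, ext₀, hinj, hrel, hext, hφ, hcoh⟩ := exists_relational_extension A
  let m : V ↪ X := ⟨φ₀, hinj⟩
  let G : Set (Equiv.Perm X) := {σ | ∀ R t, t ∈ rel R ↔ σ ∘ t ∈ rel R}
  have hfin : Set.Finite {c : X × Str L X |
      ∃ σ ∈ G, ∃ v, c = closureCode A (m.trans σ.toEmbedding) v} := by
    refine (Set.finite_range fun q : Equiv.Perm X × V =>
      closureCode A (m.trans q.1.toEmbedding) q.2).subset ?_
    rintro _ ⟨σ, -, v, rfl⟩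
    exact ⟨(σ, v), rfl⟩
  obtain ⟨W, _, c, hc, hrange⟩ := exists_injective_range_eq.{w} hfin
  have hc' : ∀ w, ∃ σ ∈ G, ∃ v, c w = closureCode A (m.trans σ.toEmbedding) v := fun w => by
    have : c w ∈ Set.range c := ⟨w, rfl⟩
    rwa [hrange] at this
  have hc'' : ∀ σ ∈ G, ∀ v, ∃ w, c w = closureCode A (m.trans σ.toEmbedding) v := by
    intro σ hσ v
    have : closureCode A (m.trans σ.toEmbedding) v ∈ Set.range c := by
      rw [hrange]
      exact ⟨σ, hσ, v, rfl⟩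
    exact this
  let C : Cover L W X :=
    { rel := fun R => {t | (fun i => (c (t i)).1) ∈ rel R}
      proj := fun w => (c w).1
      le := fun w' w => (c w').2 = below (c w).2 (c w').1
      val := fun F w t => (c w).2.fn F (fun _ => (c w).1) t
      val_unique := fun F w s t => (c w).2.fn_unique F _ s t
      val_card := fun F w s => (c w).2.fn_card F _ s
      exists_le := by
        intro F w s hs y hy
        obtain ⟨σ, hσ, v, hw⟩ := hc' w
        rw [hw] at hs
        obtain ⟨s₀, hs₀, rfl⟩ := push_fn_iff.1 (below_fn_self.1 hs)
        obtain ⟨v', hv', rfl⟩ := Finset.mem_map.1 hy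
        obtain ⟨w', hw'⟩ := hc'' σ hσ v'
        refine ⟨w', ?_, by rw [hw']; rfl⟩
        rw [hw, hw']
        refine (below_below hL (push_reach.2 ⟨v', ?_, rfl⟩)).symm
        exact Relation.ReflTransGen.single ⟨F, s₀, hs₀, hv'⟩
      le_unique := by
        intro w w₁ w₂ h₁ h₂ h
        refine hc (Prod.ext h ?_)
        rw [h₁, h₂, h] }
  -- the permutations of `W` induced by the permutations in `G`
  have hT : ∀ σ ∈ G, ∃ g : Equiv.Perm W, ∀ w, c (g w) = pushCode σ.toEmbedding (c w) := by
    intro σ hσ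
    have hg : ∀ w, ∃ w', c w' = pushCode σ.toEmbedding (c w) := by
      intro w
      obtain ⟨τ, hτ, v, hw⟩ := hc' w
      rw [hw, pushCode_closureCode]
      exact hc'' (σ * τ) (fun R t => (hτ R t).trans (hσ R _)) v
    choose g hg using hg
    have hsurj : Function.Surjective g := by
      intro w
      obtain ⟨τ, hτ, v, hw⟩ := hc' w
      have hinv : σ⁻¹ * τ ∈ G := by
        intro R t
        rw [hτ R t, hσ R ((σ⁻¹ * τ : Equiv.Perm X) ∘ t)]
        have : σ ∘ (σ⁻¹ * τ : Equiv.Perm X) ∘ t = τ ∘ t := by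
          ext i; simp
        rw [this]
      obtain ⟨w', hw'⟩ := hc'' _ hinv v
      refine ⟨w', hc ?_⟩
      rw [hg, hw', pushCode_closureCode, hw]
      congr 1
      ext i; simp
    exact ⟨Equiv.ofBijective g ⟨Finite.injective_iff_surjective.2 hsurj, hsurj⟩, hg⟩
  have haut : ∀ σ ∈ G, ∀ g : Equiv.Perm W, (∀ w, c (g w) = pushCode σ.toEmbedding (c w)) →
      (C.toStr hL).IsAut g := by
    intro σ hσ g hg
    refine Cover.isAut_toStr hL (γ := σ.toEmbedding) (fun w => by simp only [C, hg]; rfl)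
      (fun w w' h => ?_) (fun F w t h => ?_) (fun F w t h => ?_) fun R t => ?_
    · change (c w').2 = _ at h
      change (c (g w')).2 = below (c (g w)).2 (c (g w')).1
      rw [hg, hg]
      simp only [pushCode]
      rw [h, push_below]
    · change (c (g w)).2.fn F (fun _ => (c (g w)).1) _
      rw [hg]
      exact push_fn_iff.2 ⟨t, h, rfl⟩
    · change (c (g w)).2.fn F (fun _ => (c (g w)).1) _ at h
      rw [hg] at h
      obtain ⟨s, hs, -⟩ := push_fn_iff.1 h
      exact ⟨s, hs⟩
    · change _ ↔ (fun i => (c (g (t i))).1) ∈ rel R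
      simp only [hg]
      exact hσ R _
  have hφex : ∀ v, ∃ w, c w = closureCode A m v := fun v =>
    hc'' 1 (fun R t => Iff.rfl) v
  choose φ hφc using hφex
  choose g hg using fun p : A.PartialAut => hT (ext₀ p) (hext p)
  have hemb : IsEmbedding A (C.toStr hL) φ := by
    refine Cover.isEmbedding_toStr hL (φ₀ := m) (fun v => by simp only [C, hφc]; rfl)
      (fun v v' h => ?_) (fun F v s h => ?_) (fun F v t h => ?_) fun R t => ?_
    · change (c (φ v')).2 = below (c (φ v)).2 (c (φ v')).1
      rw [hφc, hφc]
      exact (below_below hL (push_reach.2 ⟨v', Relation.ReflTransGen.single h, rfl⟩)).symm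
    · change (c (φ v)).2.fn F (fun _ => (c (φ v)).1) _
      rw [hφc]
      exact below_fn_self.2 (push_fn_iff.2 ⟨s, h, rfl⟩)
    · change (c (φ v)).2.fn F (fun _ => (c (φ v)).1) _ at h
      rw [hφc] at h
      obtain ⟨s, hs, -⟩ := push_fn_iff.1 (below_fn_self.1 h)
      exact ⟨s, hs⟩
    · change _ ↔ (fun i => (c (φ (t i))).1) ∈ rel R
      simp only [hφc]
      exact hrel R t
  have hexts : ∀ p, (C.toStr hL).IsAut (g p) ∧ p.ExtendsTo φ (g p) := fun p => by
    refine ⟨haut _ (hext p) _ (hg p), PartialAut.extendsTo_iff.2 fun x hx => hc ?_⟩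
    rw [hg, hφc, hφc, pushCode_closureCode, closureCode_trans_of_extends hL (hφ p) hx]
  refine ⟨W, inferInstance, C.toStr hL, φ, ⟨hemb, fun p => ⟨g p, hexts p⟩⟩, g, hexts,
    fun p q r H => funext fun w => hc ?_⟩
  rw [Function.comp_apply, hg, hg, hg, pushCode_pushCode, hcoh p q r H]
  rfl

end Str

end PLanguage

namespace PLanguage

namespace Str

variable {L : PLanguage.{u, v}} {V W X : Type w}

/-! ### Irreducible substructure faithfulness: generic valuations -/

/-- A family `u` of vertices of `B` is bad (with respect to `φ`) if no automorphism of `B` moves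
it into the range of `φ`. The index type has one element more than `X`, so that every nonempty
subset of `X` is the range of a family and no injective valuation of all indices by elements
of `X` exists. -/
def Bad (B : Str L X) (φ : V → X) (u : Option X → X) : Prop :=
  ∀ g : Equiv.Perm X, B.IsAut g → ∃ i, g (u i) ∉ Set.range φ

theorem IsAut.bad_symm_comp {B : Str L X} {φ : V → X} {u : Option X → X} {g : Equiv.Perm X}
    (hg : B.IsAut g) : B.Bad φ (g.symm ∘ u) ↔ B.Bad φ u := by
  constructor
  · intro h f hf
    obtain ⟨i, hi⟩ := h (f * g) (hf.mul hg)
    exact ⟨i, by simpa using hi⟩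
  · intro h f hf
    exact h (f * g⁻¹) (hf.mul hg.inv)

theorem Bad.exists_injOn {B : Str L X} {φ : V → X} {u : Option X → X} (h : B.Bad φ u) :
    ∃ a : Option X → X, Set.InjOn a {i | u i ∈ Set.range φ} := by
  classical
  obtain ⟨i₀, hi₀⟩ := h 1 (isAut_one B)
  -- the index `i₀` needs no value, so swapping it with `none` leaves only values in `X`
  let σ := Equiv.swap i₀ none
  have hσ : ∀ i, u i ∈ Set.range φ → ∃ x, σ i = some x := by
    intro i hi
    refine Option.ne_none_iff_exists'.1 fun hn => ?_
    have : i = i₀ := σ.injective (by rw [hn]; exact (Equiv.swap_apply_left _ _).symm)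
    exact hi₀ (this ▸ hi)
  refine ⟨fun i => (σ i).getD (u i), fun i hi j hj hij => σ.injective ?_⟩
  obtain ⟨x, hx⟩ := hσ i hi
  obtain ⟨y, hy⟩ := hσ j hj
  simp only [hx, hy, Option.getD_some] at hij
  rw [hx, hy, hij]

/-- A vertex of `B` with a valuation: for every bad family, an injective assignment of values to
those indices whose vertices lie in the closure of the given vertex. -/
@[ext]
structure ValuedVertex (B : Str L X) (φ : V → X) where
  base : X
  val : (Option X → X) → Option X → Option X
  isSome_iff : ∀ u i, (val u i).isSome ↔ B.Bad φ u ∧ B.Reach base (u i)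
  inj : ∀ u i j a, val u i = some a → val u j = some a → i = j

namespace ValuedVertex

variable {B : Str L X} {φ : V → X}

instance [Finite X] : Finite (ValuedVertex B φ) :=
  Finite.of_injective (fun w : ValuedVertex B φ => (w.base, w.val)) fun _ _ h =>
    ValuedVertex.ext (congrArg Prod.fst h) (congrArg Prod.snd h)

/-- The valuation of `w'` is a restriction of the valuation of `w`. -/
def Le (w' w : ValuedVertex B φ) : Prop := ∀ u i a, w'.val u i = some a → w.val u i = some a

/-- Two valued vertices are compatible if the union of their valuations is again a function and
injective. -/
def Compat (w w' : ValuedVertex B φ) : Prop :=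
  ∀ u i j a b, w.val u i = some a → w'.val u j = some b → (a = b ↔ i = j)

theorem reach_of_val {w : ValuedVertex B φ} {u : Option X → X} {i : Option X} {a : X}
    (h : w.val u i = some a) : B.Bad φ u ∧ B.Reach w.base (u i) :=
  (w.isSome_iff u i).1 (by rw [h]; rfl)

theorem Compat.symm {w w' : ValuedVertex B φ} (h : Compat w w') : Compat w' w :=
  fun u i j a b ha hb => by rw [eq_comm, h u j i b a hb ha, eq_comm]

theorem Compat.mono {w w' a b : ValuedVertex B φ} (h : Compat w w') (ha : Le a w) (hb : Le b w') :
    Compat a b :=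
  fun u i j _ _ hi hj => h u i j _ _ (ha u i _ hi) (hb u j _ hj)

theorem compat_self (w : ValuedVertex B φ) : Compat w w := by
  intro u i j a b ha hb
  constructor
  · rintro rfl
    exact w.inj u i j a ha hb
  · rintro rfl
    exact Option.some_injective _ (ha.symm.trans hb)

/-- Compatibility makes the projection injective: equal base points force equal domains of the
valuations. -/
theorem eq_of_compat {w w' : ValuedVertex B φ} (h : Compat w w') (hb : w.base = w'.base) : w = w' := by
  refine ValuedVertex.ext hb (funext fun u => funext fun i => ?_)
  have hsome : (w.val u i).isSome ↔ (w'.val u i).isSome := by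
    rw [w.isSome_iff, w'.isSome_iff, hb]
  rcases h1 : w.val u i with _ | a
  · rcases h2 : w'.val u i with _ | b
    · rfl
    · simp [h1, h2] at hsome
  · rcases h2 : w'.val u i with _ | b
    · simp [h1, h2] at hsome
    · rw [(h u i i a b h1 h2).2 rfl]

open Classical in
/-- The restriction of a valuation to the closure of `y`. -/
noncomputable def restrict (w : ValuedVertex B φ) (y : X) (hy : B.Reach w.base y) : ValuedVertex B φ where
  base := y
  val u i := if B.Reach y (u i) then w.val u i else none
  isSome_iff u i := by
    split_ifs with h
    · rw [w.isSome_iff, iff_true_intro h, iff_true_intro (show B.Reach w.base (u i) from hy.trans h)]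
    · simp [h]
  inj u i j a hi hj := by
    split_ifs at hi hj
    exact w.inj u i j a hi hj

theorem restrict_le (w : ValuedVertex B φ) (y : X) (hy : B.Reach w.base y) : Le (w.restrict y hy) w := by
  intro u i a h
  simp only [restrict] at h
  split_ifs at h
  exact h

/-- The cover of `B` whose vertices are the valued vertices. The tuples of its relations are
pairwise compatible. -/
def cover (B : Str L X) (φ : V → X) : Cover L (ValuedVertex B φ) X where
  rel R := {t | base ∘ t ∈ B.rel R ∧ ∀ i j, Compat (t i) (t j)}
  proj := base
  le := Le
  val F w t := B.fn F (fun _ => w.base) t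
  val_unique F _ s t := B.fn_unique F _ s t
  val_card F _ s := B.fn_card F _ s
  exists_le F w s hs y hy :=
    ⟨w.restrict y (Relation.ReflTransGen.single ⟨F, s, hs, hy⟩), restrict_le _ _ _, rfl⟩
  le_unique w _ _ h₁ h₂ h := eq_of_compat ((compat_self w).mono h₁ h₂) h

/-- Apply the automorphism `g` to the vertex and the permutations `ρ` to the values. -/
def move {g : Equiv.Perm X} (hg : B.IsAut g) (ρ : (Option X → X) → Equiv.Perm X)
    (w : ValuedVertex B φ) : ValuedVertex B φ where
  base := g w.base
  val u i := (w.val (g.symm ∘ u) i).map (ρ u)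
  isSome_iff u i := by
    rw [Option.isSome_map, w.isSome_iff, hg.bad_symm_comp, ← hg.reach_iff]
    simp
  inj u i j a hi hj := by
    obtain ⟨b, hb, rfl⟩ := Option.map_eq_some_iff.1 hi
    obtain ⟨c, hc, hcb⟩ := Option.map_eq_some_iff.1 hj
    obtain rfl := (ρ u).injective hcb
    exact w.inj _ i j _ hb hc

variable {g : Equiv.Perm X} (hg : B.IsAut g) (ρ : (Option X → X) → Equiv.Perm X)

theorem move_val_comp (w : ValuedVertex B φ) (u : Option X → X) (i : Option X) :
    (w.move hg ρ).val (g ∘ u) i = (w.val u i).map (ρ (g ∘ u)) := by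
  have : g.symm ∘ g ∘ u = u := by ext; simp
  simp only [move, this]

theorem move_injective : Function.Injective (move (φ := φ) hg ρ) := by
  intro w w' h
  refine ValuedVertex.ext (g.injective (congrArg base h)) (funext fun u => funext fun i => ?_)
  have h1 := move_val_comp hg ρ w u i
  rw [h, move_val_comp] at h1
  exact (Option.map_injective (ρ _).injective h1).symm

theorem move_le {w w' : ValuedVertex B φ} (h : Le w' w) : Le (w'.move hg ρ) (w.move hg ρ) := by
  intro u i a ha
  obtain ⟨b, hb, rfl⟩ := Option.map_eq_some_iff.1 ha
  exact Option.map_eq_some_iff.2 ⟨b, h _ _ _ hb, rfl⟩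

theorem move_compat_iff {w w' : ValuedVertex B φ} :
    Compat (w.move hg ρ) (w'.move hg ρ) ↔ Compat w w' := by
  constructor
  · intro h u i j a b ha hb
    have := h (g ∘ u) i j (ρ (g ∘ u) a) (ρ (g ∘ u) b) (by rw [move_val_comp, ha]; rfl)
      (by rw [move_val_comp, hb]; rfl)
    rwa [(ρ (g ∘ u)).injective.eq_iff] at this
  · intro h u i j a b ha hb
    obtain ⟨a, ha', rfl⟩ := Option.map_eq_some_iff.1 ha
    obtain ⟨b, hb', rfl⟩ := Option.map_eq_some_iff.1 hb
    rw [(ρ u).injective.eq_iff]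
    exact h _ i j a b ha' hb'

/-- The permutation of the valued vertices given by `move`. -/
noncomputable def movePerm [Finite X] (φ : V → X) {g : Equiv.Perm X} (hg : B.IsAut g)
    (ρ : (Option X → X) → Equiv.Perm X) : Equiv.Perm (ValuedVertex B φ) :=
  Equiv.ofBijective (move hg ρ) (Finite.injective_iff_bijective.1 (move_injective hg ρ))

theorem isAut_movePerm [Finite X] (hL : ∀ F : L.Func, L.domArity F = 1) :
    ((cover B φ).toStr hL).IsAut (movePerm φ hg ρ) := by
  refine Cover.isAut_toStr hL (γ := g.toEmbedding) (fun w => rfl) (fun w w' h => move_le hg ρ h)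
    (fun F w t h => IsEmbedding.fn_map hg h) (fun F w t h => ?_) fun R t => ?_
  · exact (IsEmbedding.dom_iff hg F _).2 ⟨t, h⟩
  · exact and_congr (IsEmbedding.rel_iff hg R _)
      (forall_congr' fun i => forall_congr' fun j => (move_compat_iff hg ρ).symm)

section Point

variable (hφ : B.IsClosed (Set.range φ)) {a : (Option X → X) → Option X → X}
  (ha : ∀ u, B.Bad φ u → Set.InjOn (a u) {i | u i ∈ Set.range φ})

open Classical in
/-- The vertex `φ v`, with the valuation given by fixed injections `a u` of the indices of
vertices in the range of `φ`. -/
noncomputable def point (hφ : B.IsClosed (Set.range φ)) {a : (Option X → X) → Option X → X}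
    (ha : ∀ u, B.Bad φ u → Set.InjOn (a u) {i | u i ∈ Set.range φ}) (v : V) : ValuedVertex B φ where
  base := φ v
  val u i := if B.Bad φ u ∧ B.Reach (φ v) (u i) then some (a u i) else none
  isSome_iff u i := by split_ifs with h <;> simp [h]
  inj u i j b hi hj := by
    split_ifs at hi hj with h1 h2
    exact ha u h1.1 (h1.2.mem_of_isClosed hφ ⟨v, rfl⟩) (h2.2.mem_of_isClosed hφ ⟨v, rfl⟩)
      (Option.some_injective _ (hi.trans hj.symm))

theorem point_val_eq_some {v : V} {u : Option X → X} {i : Option X} {b : X} :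
    (point hφ ha v).val u i = some b ↔ (B.Bad φ u ∧ B.Reach (φ v) (u i)) ∧ a u i = b := by
  simp only [point]
  split_ifs with h <;> simp [h]

theorem compat_point (v v' : V) : Compat (point hφ ha v) (point hφ ha v') := by
  intro u i j b c hb hc
  obtain ⟨⟨hu, hi⟩, rfl⟩ := (point_val_eq_some hφ ha).1 hb
  obtain ⟨⟨-, hj⟩, rfl⟩ := (point_val_eq_some hφ ha).1 hc
  exact (ha u hu).eq_iff (hi.mem_of_isClosed hφ ⟨v, rfl⟩) (hj.mem_of_isClosed hφ ⟨v', rfl⟩)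

theorem move_eq_point {w : ValuedVertex B φ} {v : V} (hb : g w.base = φ v)
    (h : ∀ u i b, w.val (g.symm ∘ u) i = some b → ρ u b = a u i) :
    w.move hg ρ = point hφ ha v := by
  refine eq_of_compat (fun u i j b c hi hj => ?_) hb
  obtain ⟨b, hb', rfl⟩ := Option.map_eq_some_iff.1 hi
  obtain ⟨⟨hu, hvj⟩, rfl⟩ := (point_val_eq_some hφ ha).1 hj
  rw [h u i b hb']
  refine (ha u hu).eq_iff (Reach.mem_of_isClosed hφ ?_ ⟨v, hb.symm⟩)
    (hvj.mem_of_isClosed hφ ⟨v, rfl⟩)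
  have := (reach_of_val hb').2
  rw [← hg.reach_iff] at this
  simpa using this

theorem isEmbedding_point [Finite X] (hL : ∀ F : L.Func, L.domArity F = 1) {A : Str L V}
    (hA : IsEmbedding A B φ) : IsEmbedding A ((cover B φ).toStr hL) (point hφ ha) := by
  refine Cover.isEmbedding_toStr hL (φ₀ := ⟨φ, hA.injective⟩) (fun v => rfl)
    (fun v v' h u i b hb => ?_) (fun F v s h => hA.fn_map h) (fun F v t h => ?_) fun R t => ?_
  · obtain ⟨⟨hu, hi⟩, rfl⟩ := (point_val_eq_some hφ ha).1 hb
    exact (point_val_eq_some hφ ha).2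
      ⟨⟨hu, (hA.reach (Relation.ReflTransGen.single h)).trans hi⟩, rfl⟩
  · exact (hA.dom_iff F _).2 ⟨t, h⟩
  · exact (hA.rel_iff R t).trans
      (and_iff_left fun i j => compat_point hφ ha (t i) (t j)).symm

end Point

theorem le_of_reach [Finite X] (hL : ∀ F : L.Func, L.domArity F = 1) {w w' : ValuedVertex B φ}
    (h : ((cover B φ).toStr hL).Reach w w') : Le w' w := by
  induction h with
  | refl => exact fun _ _ _ h => h
  | tail _ h ih => exact fun u i a ha => ih u i a (Cover.le_of_arrow hL h u i a ha)

/-- The vertices of an irreducible substructure are pairwise compatible. -/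
theorem compat_of_irreducible [Finite X] (hL : ∀ F : L.Func, L.domArity F = 1)
    {S : Set (ValuedVertex B φ)} (hS : ((cover B φ).toStr hL).IsClosed S)
    (hirr : (((cover B φ).toStr hL).induce S).Irreducible) {w w' : ValuedVertex B φ} (hw : w ∈ S)
    (hw' : w' ∈ S) : Compat w w' := by
  have hle : ∀ x y : S, (((cover B φ).toStr hL).induce S).Reach x y → Le (y : ValuedVertex B φ) x :=
    fun x y h => le_of_reach hL ((isEmbedding_induce _ hS).reach h)
  rcases hirr.exists_reach hL ⟨w, hw⟩ ⟨w', hw'⟩ with ⟨z, h1, h2⟩ | ⟨R, t, ht, i, j, h1, h2⟩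
  · exact (compat_self (z : ValuedVertex B φ)).mono (hle _ _ h1) (hle _ _ h2)
  · exact (ht.2 i j).mono (hle _ _ h1) (hle _ _ h2)

/-- Pairwise compatible vertices do not project onto the range of a bad family, since their
valuations would combine to an injection from `Option X` to `X`. -/
theorem exists_isAut_of_compat [Finite X] {S : Set (ValuedVertex B φ)}
    (hS : ∀ w ∈ S, ∀ w' ∈ S, Compat w w') :
    ∃ g : Equiv.Perm X, B.IsAut g ∧ ∀ w ∈ S, g w.base ∈ Set.range φ := by
  classical
  rcases S.eq_empty_or_nonempty with rfl | ⟨w₀, hw₀⟩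
  · exact ⟨1, isAut_one B, fun w hw => hw.elim⟩
  -- a family whose range is the projection of `S`
  let u : Option X → X := fun i =>
    i.elim w₀.base fun x => if x ∈ base '' S then x else w₀.base
  have hu : ∀ i, ∃ w ∈ S, w.base = u i := by
    rintro (_ | x)
    · exact ⟨w₀, hw₀, rfl⟩
    · by_cases hx : x ∈ base '' S
      · simp only [u, Option.elim_some, if_pos hx]
        exact hx
      · exact ⟨w₀, hw₀, by simp only [u, Option.elim_some, if_neg hx]⟩
  have hbad : ¬ B.Bad φ u := by
    intro hbad
    choose w hwS hw using hu
    have hval : ∀ i, ∃ b, (w i).val u i = some b := fun i =>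
      Option.isSome_iff_exists.1 (((w i).isSome_iff u i).2
        ⟨hbad, by rw [hw]; exact Relation.ReflTransGen.refl⟩)
    choose b hb using hval
    have hinj : Function.Injective b := fun i j hij =>
      (hS _ (hwS i) _ (hwS j) u i j _ _ (hb i) (hb j)).1 hij
    have := Fintype.ofFinite X
    have := Fintype.card_le_of_injective b hinj
    simp at this
  unfold Bad at hbad
  push Not at hbad
  obtain ⟨g, hg, hgu⟩ := hbad
  refine ⟨g, hg, fun w hw => ?_⟩
  have : u (some w.base) = w.base := if_pos ⟨w, hw, rfl⟩
  rw [← this]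
  exact hgu _

end ValuedVertex

open ValuedVertex in
/-- A finite coherent EPPA-extension can be made irreducible substructure faithful. -/
theorem IsCoherentEPPAExtension.exists_faithful (hL : ∀ F : L.Func, L.domArity F = 1) [Finite X]
    {A : Str L V} {B : Str L X} {φ : V → X} (h : IsCoherentEPPAExtension A B φ) :
    ∃ (W : Type w) (_ : Finite W) (C : Str L W) (ψ : V → W),
      IsCoherentEPPAExtension A C ψ ∧ IsIrreducibleFaithful C ψ := by
  classical
  obtain ⟨⟨hA, -⟩, ext, hext, hcoh⟩ := h
  let _ : LinearOrder X := IsWellOrder.linearOrder WellOrderingRel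
  have hφ : B.IsClosed (Set.range φ) := by
    rw [← Set.image_univ]
    exact hA.isClosed_image (isClosed_univ A)
  have hex : ∀ u, ∃ a : Option X → X, B.Bad φ u → Set.InjOn a {i | u i ∈ Set.range φ} := by
    intro u
    by_cases hu : B.Bad φ u
    · obtain ⟨a, ha⟩ := hu.exists_injOn
      exact ⟨a, fun _ => ha⟩
    · exact ⟨u, fun h => (hu h).elim⟩
  choose a ha using hex
  -- the indices at which the permutation of values is prescribed by a partial automorphism
  let J : A.PartialAut → (Option X → X) → Set (Option X) := fun p u =>
    {i | B.Bad φ u ∧ (ext p).symm (u i) ∈ φ '' p.dom}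
  have hextφ : ∀ p, ∀ x ∈ p.dom, ext p (φ x) = φ (p.toFun x) := fun p =>
    PartialAut.extendsTo_iff.1 (hext p).2
  have hJ : ∀ p u, ∀ i ∈ J p u, u i ∈ φ '' p.ran := by
    rintro p u i ⟨-, x, hx, hxu⟩
    refine ⟨p.toFun x, p.toFun_mem hx, ?_⟩
    rw [← hextφ p x hx, hxu, Equiv.apply_symm_apply]
  have hρex : ∀ p u, ∃ ρ : Equiv.Perm X, (∀ i ∈ J p u, ρ (a ((ext p).symm ∘ u) i) = a u i) ∧
      StrictMonoOn ρ (a ((ext p).symm ∘ u) '' J p u)ᶜ := by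
    intro p u
    refine exists_perm_strictMonoOn (J p u) _ _ fun i hi j hj => ?_
    have hu := (hext p).1.bad_symm_comp.2 hi.1
    rw [(ha _ hi.1).eq_iff (Set.image_subset_range _ _ (hJ p u i hi))
      (Set.image_subset_range _ _ (hJ p u j hj)), (ha _ hu).eq_iff
      (Set.image_subset_range _ _ hi.2) (Set.image_subset_range _ _ hj.2)]
  choose ρ hρ hmono using hρex
  let T : A.PartialAut → Equiv.Perm (ValuedVertex B φ) := fun p => movePerm φ (hext p).1 (ρ p)
  have hT : ∀ p, ((cover B φ).toStr hL).IsAut (T p) ∧ p.ExtendsTo (point hφ ha) (T p) := by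
    refine fun p => ⟨isAut_movePerm _ _ hL, PartialAut.extendsTo_iff.2 fun x hx => ?_⟩
    refine move_eq_point (hext p).1 (ρ p) hφ ha (hextφ p x hx) fun u i b hb => ?_
    obtain ⟨⟨hu, hr⟩, rfl⟩ := (point_val_eq_some hφ ha).1 hb
    exact hρ p u i ⟨(hext p).1.bad_symm_comp.1 hu,
      hr.mem_of_isClosed (hA.isClosed_image p.dom_closed) ⟨x, hx, rfl⟩⟩
  refine ⟨ValuedVertex B φ, inferInstance, (cover B φ).toStr hL, point hφ ha,
    ⟨⟨isEmbedding_point hφ ha hL hA, fun p => ⟨T p, hT p⟩⟩, T, hT, fun f g h H => ?_⟩, ?_⟩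
  · have hmul : ext h = ext g * ext f := Equiv.ext fun x => congrFun (hcoh f g h H) x
    have hsymm : ∀ u : Option X → X, (ext h).symm ∘ u = (ext f).symm ∘ (ext g).symm ∘ u := by
      intro u
      rw [hmul]
      rfl
    -- the prescriptions for `f` and `g` are made at the same indices as those for `h`
    have hJf : ∀ u, J f ((ext g).symm ∘ u) = J h u := by
      intro u
      ext i
      have hi := congrFun (hsymm u) i
      simp only [Function.comp_apply] at hi
      simp only [J, Set.mem_ofPred_eq, (hext g).1.bad_symm_comp, Function.comp_apply, hi, H.1]
    have hJg : ∀ u, J g u = J h u := by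
      intro u
      ext i
      have hi := congrFun (hsymm u) i
      simp only [Function.comp_apply] at hi
      simp only [J, Set.mem_ofPred_eq, hi, ← H.1, ← H.2.1]
      refine and_congr_right fun _ => ?_
      have himg : φ '' f.ran = ext f '' (φ '' f.dom) := by
        rw [← f.image_toFun, Set.image_image, Set.image_image]
        exact Set.image_congr fun x hx => (hextφ f x hx).symm
      rw [himg, Equiv.image_eq_preimage_symm]
      rfl
    have hρmul : ∀ u, ρ h u = ρ g u * ρ f ((ext g).symm ∘ u) := by
      intro u
      have hf : ∀ i ∈ J h u, ρ f ((ext g).symm ∘ u) (a ((ext h).symm ∘ u) i) =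
          a ((ext g).symm ∘ u) i := fun i hi => by
        rw [hsymm]
        exact hρ f _ i (hJf u ▸ hi)
      have hg : ∀ i ∈ J h u, ρ g u (a ((ext g).symm ∘ u) i) = a u i := fun i hi =>
        hρ g u i (hJg u ▸ hi)
      refine perm_eq_of_strictMonoOn (D := a ((ext h).symm ∘ u) '' J h u) ?_ (hmono h u) ?_
      · rintro _ ⟨i, hi, rfl⟩
        rw [hρ h u i hi, Equiv.Perm.mul_apply, hf i hi, hg i hi]
      · have hmf := hmono f ((ext g).symm ∘ u)
        rw [hJf, ← hsymm] at hmf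
        have hmg := hmono g u
        rw [hJg] at hmg
        refine hmg.comp hmf ?_
        rintro x hx ⟨i, hi, hix⟩
        rw [← hf i hi] at hix
        exact hx ⟨i, hi, (ρ f _).injective hix⟩
    funext w
    refine ValuedVertex.ext ?_ (funext fun u => funext fun i => ?_)
    · exact congrFun (congrArg DFunLike.coe hmul) w.base
    · change (w.val ((ext h).symm ∘ u) i).map (ρ h u) =
        ((w.val ((ext f).symm ∘ (ext g).symm ∘ u) i).map (ρ f ((ext g).symm ∘ u))).map (ρ g u)
      rw [Option.map_map, hsymm, hρmul]
      rfl
  · intro S hS hirr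
    have hcompat : ∀ w ∈ S, ∀ w' ∈ S, Compat w w' := fun w hw w' hw' =>
      compat_of_irreducible hL hS hirr hw hw'
    obtain ⟨g, hg, hgS⟩ := exists_isAut_of_compat hcompat
    -- the joint valuation of the pairwise compatible vertices of `S`
    have hκex : ∀ u i, ∃ b, ∀ w ∈ S, ∀ b', w.val (g.symm ∘ u) i = some b' → b' = b := by
      intro u i
      by_cases hi : ∃ w ∈ S, ∃ b, w.val (g.symm ∘ u) i = some b
      · obtain ⟨w, hw, b, hb⟩ := hi
        exact ⟨b, fun w' hw' b' hb' => (hcompat w' hw' w hw _ i i b' b hb' hb).2 rfl⟩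
      · exact ⟨u i, fun w hw b hb => (hi ⟨w, hw, b, hb⟩).elim⟩
    choose κ hκ using hκex
    -- permute the values so that the joint valuation of `S` becomes the one of the copy of `A`
    have hτex : ∀ u, ∃ τ : Equiv.Perm X, ∀ i, (∃ w ∈ S, ∃ b, w.val (g.symm ∘ u) i = some b) →
        τ (κ u i) = a u i := by
      intro u
      suffices h : _ from (exists_perm_strictMonoOn
        {i | ∃ w ∈ S, ∃ b, w.val (g.symm ∘ u) i = some b} (κ u) (a u) h).imp fun _ h => h.1
      rintro i ⟨w, hw, b, hb⟩ j ⟨w', hw', b', hb'⟩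
      have hmem : ∀ {w : ValuedVertex B φ} {i b}, w ∈ S → w.val (g.symm ∘ u) i = some b →
          u i ∈ Set.range φ := by
        intro w i b hw hb
        have hr := (reach_of_val hb).2
        rw [← hg.reach_iff] at hr
        simpa using hr.mem_of_isClosed hφ (hgS w hw)
      rw [← hκ u i w hw b hb, ← hκ u j w' hw' b' hb', hcompat w hw w' hw' _ i j b b' hb hb',
        (ha u (hg.bad_symm_comp.1 (reach_of_val hb).1)).eq_iff (hmem hw hb) (hmem hw' hb')]
    choose τ hτ using hτex
    refine ⟨movePerm φ hg τ, isAut_movePerm hg τ hL, ?_⟩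
    rintro _ ⟨w, hw, rfl⟩
    obtain ⟨v, hv⟩ := hgS w hw
    refine ⟨v, (move_eq_point hg τ hφ ha hv.symm fun u i b hb => ?_).symm⟩
    rw [hκ u i w hw b hb]
    exact hτ u i ⟨w, hw, b, hb⟩

end Str

end PLanguage

namespace PLanguage

namespace Str

variable {L : PLanguage.{u, v}} {U V W X : Type w}

/-! ### Free amalgamation classes -/

theorem induce_fn_iff {A : Str L V} {S : Set V} (hS : A.IsClosed S) {F : L.Func}
    {x : Fin (L.domArity F) → S} {s : Finset S} :
    (A.induce S).fn F x s ↔ A.fn F (fun i => (x i : V)) (s.map (.subtype (· ∈ S))) :=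
  (A.isEmbedding_induce hS).fn_iff

/-- Two embeddings into `B` with the same range have isomorphic sources. -/
theorem exists_isIso_of_range_eq {A : Str L U} {B : Str L V} {C : Str L W} {f : U → W} {g : V → W}
    (hf : IsEmbedding A C f) (hg : IsEmbedding B C g) (h : Set.range f = Set.range g) :
    ∃ e : U ≃ V, IsIso A B e := by
  let e : U ≃ V := (Equiv.ofInjective f hf.injective).trans
    ((Equiv.setCongr h).trans (Equiv.ofInjective g hg.injective).symm)
  have he : ∀ x, g (e x) = f x := fun x => by
    have := Equiv.apply_ofInjective_symm hg.injective
      (Equiv.setCongr h (Equiv.ofInjective f hf.injective x))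
    exact this
  have hcomp : ∀ {n : ℕ} (x : Fin n → U), g ∘ e ∘ x = f ∘ x := fun x => funext fun i => he _
  refine ⟨e, isEmbedding_of_fn_map e.injective (fun R x => ?_) (fun F x s hs => ?_)
    fun F x t ht => ?_⟩
  · rw [hf.rel_iff, hg.rel_iff, hcomp]
  · rw [hg.fn_iff, hcomp, Finset.map_map]
    convert hf.fn_map hs using 2
    ext x
    exact he x
  · have := hg.fn_map ht
    rw [hcomp] at this
    exact (hf.dom_iff F x).2 ⟨_, this⟩

theorem IsFreeAmalgamation.forall_mem_range {A : Str L U} {B₁ : Str L V} {B₂ : Str L W}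
    {C : Str L X} {α₁ : U → V} {α₂ : U → W} {β₁ : V → X} {β₂ : W → X}
    (h : IsFreeAmalgamation A B₁ B₂ C α₁ α₂ β₁ β₂) {n : ℕ} {x : Fin n → X}
    (hx : ¬ ((∃ i, x i ∈ β₁ '' (Set.range α₁)ᶜ) ∧ (∃ j, x j ∈ β₂ '' (Set.range α₂)ᶜ))) :
    (∃ y, x = β₁ ∘ y) ∨ ∃ y, x = β₂ ∘ y := by
  have key : ∀ z, (z ∈ Set.range β₂ ∨ z ∈ β₁ '' (Set.range α₁)ᶜ) ∧
      (z ∈ Set.range β₁ ∨ z ∈ β₂ '' (Set.range α₂)ᶜ) := by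
    intro z
    have hz : z ∈ Set.range β₁ ∪ Set.range β₂ := h.union ▸ Set.mem_univ z
    constructor
    · rcases hz with ⟨a, rfl⟩ | hz
      · by_cases ha : a ∈ Set.range α₁
        · obtain ⟨c, rfl⟩ := ha
          exact Or.inl ⟨α₂ c, (congrFun h.comm c).symm⟩
        · exact Or.inr ⟨a, ha, rfl⟩
      · exact Or.inl hz
    · rcases hz with hz | ⟨a, rfl⟩
      · exact Or.inl hz
      · by_cases ha : a ∈ Set.range α₂
        · obtain ⟨c, rfl⟩ := ha
          exact Or.inl ⟨α₁ c, congrFun h.comm c⟩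
        · exact Or.inr ⟨a, ha, rfl⟩
  by_cases h1 : ∃ i, x i ∈ β₁ '' (Set.range α₁)ᶜ
  · have h2 : ∀ j, x j ∈ Set.range β₁ := fun j =>
      (key (x j)).2.resolve_right fun hj => hx ⟨h1, j, hj⟩
    choose y hy using h2
    exact Or.inl ⟨y, funext fun i => (hy i).symm⟩
  · have h2 : ∀ j, x j ∈ Set.range β₂ := fun j =>
      (key (x j)).1.resolve_right fun hj => h1 ⟨j, hj⟩
    choose y hy using h2
    exact Or.inr ⟨y, funext fun i => (hy i).symm⟩

/-- A free amalgamation maps homomorphically to any amalgamation. -/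
theorem IsFreeAmalgamation.exists_isHom {A : Str L U} {B₁ : Str L V} {B₂ : Str L W}
    {α₁ : U → V} {α₂ : U → W} {X Y : Type w} {C : Str L X} {D : Str L Y} {β₁ : V → X} {β₂ : W → X}
    {γ₁ : V → Y} {γ₂ : W → Y} (h : IsFreeAmalgamation A B₁ B₂ C α₁ α₂ β₁ β₂)
    (h' : IsAmalgamation A B₁ B₂ D α₁ α₂ γ₁ γ₂) :
    ∃ f : X → Y, IsHom C D f ∧ f ∘ β₁ = γ₁ ∧ f ∘ β₂ = γ₂ := by
  have hex : ∀ z, ∃ y, (∀ a, β₁ a = z → γ₁ a = y) ∧ (∀ b, β₂ b = z → γ₂ b = y) := by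
    intro z
    have hcompat : ∀ a b, β₁ a = β₂ b → γ₁ a = γ₂ b := by
      intro a b hab
      obtain ⟨c, rfl, rfl⟩ := (h.inter a b).1 hab
      exact congrFun h'.comm c
    have hz : z ∈ Set.range β₁ ∪ Set.range β₂ := h.union ▸ Set.mem_univ z
    rcases hz with ⟨a, rfl⟩ | ⟨b, rfl⟩
    · exact ⟨γ₁ a, fun a' ha => by rw [h.emb_left.injective ha],
        fun b hb => (hcompat a b hb.symm).symm⟩
    · exact ⟨γ₂ b, fun a ha => hcompat a b ha, fun b' hb => by rw [h.emb_right.injective hb]⟩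
  choose f hf₁ hf₂ using hex
  have e₁ : f ∘ β₁ = γ₁ := funext fun a => (hf₁ _ a rfl).symm
  have e₂ : f ∘ β₂ = γ₂ := funext fun b => (hf₂ _ b rfl).symm
  have hfn : ∀ {V : Type w} {B : Str L V} {β : V → X} {γ : V → Y}, IsEmbedding B C β →
      IsEmbedding B D γ → f ∘ β = γ → ∀ F y s, C.fn F (β ∘ y) s →
      ∃ t, D.fn F (f ∘ β ∘ y) t ∧ (t : Set Y) = f '' s := by
    rintro V B β γ hβ hγ rfl F y s hs
    obtain ⟨s', hs'⟩ := (hβ.dom_iff F y).2 ⟨s, hs⟩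
    obtain rfl := C.fn_unique F _ _ _ hs (hβ.fn_map hs')
    exact ⟨_, hγ.fn_map hs', by simp [Set.image_image]⟩
  refine ⟨f, ⟨fun R x hx => ?_, fun F x s hs => ?_⟩, e₁, e₂⟩
  · rcases h.forall_mem_range (h.rel_free R x hx) with ⟨y, rfl⟩ | ⟨y, rfl⟩
    · rw [← Function.comp_assoc, e₁]
      exact (h'.emb_left.rel_iff R y).1 ((h.emb_left.rel_iff R y).2 hx)
    · rw [← Function.comp_assoc, e₂]
      exact (h'.emb_right.rel_iff R y).1 ((h.emb_right.rel_iff R y).2 hx)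
  · rcases h.forall_mem_range (h.dom_free F x ⟨s, hs⟩) with ⟨y, rfl⟩ | ⟨y, rfl⟩
    · exact hfn h.emb_left h'.emb_left e₁ F y s hs
    · exact hfn h.emb_right h'.emb_right e₂ F y s hs

/-- Free amalgamations are unique up to isomorphism. -/
theorem IsFreeAmalgamation.exists_isIso {A : Str L U} {B₁ : Str L V} {B₂ : Str L W}
    {α₁ : U → V} {α₂ : U → W} {X Y : Type w} {C : Str L X} {D : Str L Y} {β₁ : V → X} {β₂ : W → X}
    {γ₁ : V → Y} {γ₂ : W → Y} (h : IsFreeAmalgamation A B₁ B₂ C α₁ α₂ β₁ β₂)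
    (h' : IsFreeAmalgamation A B₁ B₂ D α₁ α₂ γ₁ γ₂) : ∃ e : X ≃ Y, IsIso C D e := by
  obtain ⟨f, hf, hf₁, hf₂⟩ := h.exists_isHom h'.toIsAmalgamation
  obtain ⟨g, hg, hg₁, hg₂⟩ := h'.exists_isHom h.toIsAmalgamation
  have hgf : ∀ z, g (f z) = z := by
    intro z
    have hz : z ∈ Set.range β₁ ∪ Set.range β₂ := h.union ▸ Set.mem_univ z
    rcases hz with ⟨a, rfl⟩ | ⟨b, rfl⟩
    · exact (congrArg g (congrFun hf₁ a)).trans (congrFun hg₁ a)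
    · exact (congrArg g (congrFun hf₂ b)).trans (congrFun hg₂ b)
  have hfg : ∀ z, f (g z) = z := by
    intro z
    have hz : z ∈ Set.range γ₁ ∪ Set.range γ₂ := h'.union ▸ Set.mem_univ z
    rcases hz with ⟨a, rfl⟩ | ⟨b, rfl⟩
    · exact (congrArg f (congrFun hg₁ a)).trans (congrFun hf₁ a)
    · exact (congrArg f (congrFun hg₂ b)).trans (congrFun hf₂ b)
  exact ⟨⟨f, g, hgf, hfg⟩, isIso_of_isHom _ hf hg⟩

end Str

open Str

variable {L : PLanguage.{u, v}} {V W : Type w}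

/-- A finite structure belongs to a free amalgamation class as soon as its irreducible
substructures do. -/
theorem IsFreeAmalgamationClass.of_irreducible {K : ∀ V : Type w, Str L V → Prop}
    (hK : IsFreeAmalgamationClass K) [Finite V] (B : Str L V)
    (h : ∀ S, B.IsClosed S → (B.induce S).Irreducible → K S (B.induce S)) : K V B := by
  have key : ∀ n, ∀ S : Set V, S.ncard = n → B.IsClosed S → K S (B.induce S) := by
    intro n
    induction n using Nat.strong_induction_on with
    | _ n ih =>
    intro S hn hS
    by_cases hirr : (B.induce S).Irreducible
    · exact h S hS hirr
    obtain ⟨S₁, S₂, h₁, h₂, hne₁, hne₂, hfree⟩ := not_not.1 hirr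
    have hsub : ∀ T : Set S, (B.induce S).IsClosed T → T ≠ Set.univ →
        K T ((B.induce S).induce T) := by
      intro T hT hne
      have hemb : IsEmbedding ((B.induce S).induce T) B (Subtype.val ∘ Subtype.val) :=
        (B.isEmbedding_induce hS).comp ((B.induce S).isEmbedding_induce hT)
      have hcl := (B.isEmbedding_induce hS).isClosed_image hT
      have hlt : (Subtype.val '' T : Set V).ncard < n := by
        rw [← hn]
        refine Set.ncard_lt_ncard ?_
        refine ⟨Subtype.coe_image_subset _ _, fun hle => hne (Set.eq_univ_of_forall fun z => ?_)⟩
        obtain ⟨z', hz', hzz⟩ := hle z.2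
        rwa [← Subtype.ext hzz]
      obtain ⟨e, he⟩ := exists_isIso_of_range_eq (B.isEmbedding_induce hcl) hemb
        (by rw [Set.range_comp, Subtype.range_coe, Subtype.range_coe])
      exact hK.iso _ _ _ _ e he (ih _ hlt _ rfl hcl)
    have hinter : (B.induce S).IsClosed (S₁ ∩ S₂) := fun F x s hx hs =>
      Set.subset_inter (h₁ F x s (fun i => (hx i).1) hs) (h₂ F x s (fun i => (hx i).2) hs)
    have hne : S₁ ∩ S₂ ≠ Set.univ := fun heq =>
      hne₁ (Set.eq_univ_of_univ_subset (heq ▸ Set.inter_subset_left))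
    have hincl : ∀ {T T' : Set S} (hTT : T ⊆ T'), (B.induce S).IsClosed T →
        (B.induce S).IsClosed T' → IsEmbedding ((B.induce S).induce T) ((B.induce S).induce T')
          (Set.inclusion hTT) := by
      intro T T' hTT hT hT'
      refine isEmbedding_of_fn_map (Set.inclusion_injective hTT) (fun R x => Iff.rfl)
        (fun F x s hs => ?_) fun F x t ht => ?_
      · rw [induce_fn_iff hT', Finset.map_map]
        exact (induce_fn_iff hT).1 hs
      · exact ((isEmbedding_induce _ hT).dom_iff F x).2
          (((isEmbedding_induce _ hT').dom_iff F _).1 ⟨t, ht⟩)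
    obtain ⟨W, C, β₁, β₂, hC, hCfree⟩ := hK.free_amalgamation _ _ _ _ _ _
      (Set.inclusion Set.inter_subset_left) (Set.inclusion Set.inter_subset_right)
      (hsub _ hinter hne) (hsub _ h₁ hne₁) (hsub _ h₂ hne₂)
      (hincl _ hinter h₁) (hincl _ hinter h₂)
    obtain ⟨e, he⟩ := hCfree.exists_isIso hfree
    exact hK.iso _ _ _ _ e he hC
  have huniv := key _ Set.univ rfl (isClosed_univ B)
  exact hK.iso _ _ _ _ (Equiv.Set.univ V) (isEmbedding_induce B (isClosed_univ B)) huniv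

theorem IsFreeAmalgamationClass.of_isIrreducibleFaithful {K : ∀ V : Type w, Str L V → Prop}
    (hK : IsFreeAmalgamationClass K) [Finite W] {A : Str L V} {B : Str L W} {φ : V → W}
    (hφ : IsEmbedding A B φ) (hB : IsIrreducibleFaithful B φ) (hA : K V A) : K W B := by
  refine hK.of_irreducible B fun S hS hirr => ?_
  obtain ⟨g, hg, hgS⟩ := hB S hS hirr
  have hcl : A.IsClosed (φ ⁻¹' (g '' S)) :=
    hφ.isClosed_preimage (IsEmbedding.isClosed_image hg hS)
  obtain ⟨e, he⟩ := exists_isIso_of_range_eq (hφ.comp (A.isEmbedding_induce hcl))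
    (IsEmbedding.comp hg (B.isEmbedding_induce hS)) (by
      rw [Set.range_comp, Set.range_comp, Subtype.range_coe, Subtype.range_coe,
        Set.image_preimage_eq_of_subset hgS])
  exact hK.iso _ _ _ _ e he (hK.hereditary V A hA _ hcl)

end PLanguage

theorem theorem1p7 (L : PLanguage.{u, v}) (hL : ∀ F : L.Func, L.domArity F = 1) :
    (∀ (V : Type w) (_ : Finite V) (A : PLanguage.Str L V),
      ∃ (W : Type w) (_ : Finite W) (B : PLanguage.Str L W) (φ : V → W),
        PLanguage.Str.IsCoherentEPPAExtension A B φ ∧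
        PLanguage.Str.IsIrreducibleFaithful B φ) ∧
    (∀ K : (∀ V : Type w, PLanguage.Str L V → Prop),
      PLanguage.IsFreeAmalgamationClass K → PLanguage.HasCoherentEPPA K) := by
  have h : ∀ (V : Type w) (_ : Finite V) (A : PLanguage.Str L V),
      ∃ (W : Type w) (_ : Finite W) (B : PLanguage.Str L W) (φ : V → W),
        PLanguage.Str.IsCoherentEPPAExtension A B φ ∧
        PLanguage.Str.IsIrreducibleFaithful B φ := by
    intro V _ A
    obtain ⟨X, _, B, φ, hB⟩ := PLanguage.Str.exists_isCoherentEPPAExtension hL A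
    exact hB.exists_faithful hL
  refine ⟨h, fun K hK V A hA => ?_⟩
  obtain ⟨W, _, B, φ, hB, hfaithful⟩ := h V (hK.finite V A hA) A
  exact ⟨W, B, φ, hK.of_isIrreducibleFaithful hB.1.1 hfaithful hA, hB⟩
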